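/- Let $G=(V,E)$ be a finite simple graph. For $A\subseteq V$ and $v\in V$ let $d_A(v)$ be the number of neighbours of $v$ in $A$, and let $\partial A$ be the set of vertices outside $A$ that have a neighbour in $A$. The set $A$ is an \emph{independent offensive alliance} if it is an independent set and $d_A(v)\ge d_{V\setminus A}(v)+1$ for every $v\in\partial A$. A set $A$ is transformed into a set $B$ by a \emph{token sliding step} if $|A|=|B|$, $|A\setminus B|=1$, and the vertex of $A\setminus B$ is adjacent to the vertex of $B\setminus A$. An edge is \emph{isolated} if both of its endpoints have degree one. (1) If $A,B\subseteq V$ are independent offensive alliances of $G$ such that $A$ is transformed into $B$ by a token sliding step, then for $x\in A\setminus B$ and $y\in B\setminus A$, $\{x,y\}$ is an isolated edge of $G$. (2) The following problem is in $\mathsf{LogSPACE}$ (deterministic logarithmic space): given a finite graph $G$ and independent offensive alliances $A_s,A_t$ of $G$, is there a sequence $A_s=A_1,\dots,A_\ell=A_t$ of independent offensive alliances of $G$ such that, for each $1\le i<\ell$, $A_i$ is transformed into $A_{i+1}$ by a token sliding step? (3) The timed version is also in $\mathsf{LogSPACE}$: given in addition $T\in\mathbb N$ (in binary), is there such a sequence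 $A_s=A_1,\dots,A_\ell=A_t$ with $\ell<T$? Here instances are encoded by the adjacency matrix of $G$, the characteristic vectors of $A_s$ and $A_t$ and, in (3), the binary representation of $T$; strings that encode no valid instance are no-instances. -/

import Mathlib

/-! ### Deterministic Turing machines with a read-only input tape, and logarithmic space -/

/-- A direction in which a head moves by one cell, or stays. -/
inductive HeadMove where
  | left
  | stay
  | right

/-- What the input head can see: a letter of the input word or one of the two end markers. -/
inductive InputSymbol (α : Type) where
  | leftEnd
  | letter (a : α)
  | rightEnd

/-- A deterministic Turing machine with a two-way read-only input tape, delimited by end markers,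
and finitely many one-way infinite read-write work tapes. The machine halts when `δ` returns
`none`; its verdict is then given by `accepting`. -/
structure OfflineTM (α : Type) where
  /-- control states -/
  Q : Type
  finite_Q : Finite Q
  /-- work alphabet -/
  Γ : Type
  finite_Γ : Finite Γ
  blank : Γ
  /-- number of work tapes -/
  k : ℕ
  start : Q
  accepting : Set Q
  /-- Given the state, the scanned input symbol and the scanned work symbols: the new state, the
  move of the input head, and for each work tape the symbol to write and the move of its head. -/
  δ : Q → InputSymbol α → (Fin k → Γ) → Option (Q × HeadMove × (Fin k → Γ × HeadMove))

namespace OfflineTM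

variable {α : Type}

/-- A configuration. Work cells are numbered from `0`; the input head is at `0` on the left end
marker, at `i + 1` on the letter with index `i`, and at `w.length + 1` on the right end marker. -/
structure Config (M : OfflineTM α) where
  state : M.Q
  inputHead : ℕ
  workHead : Fin M.k → ℕ
  work : Fin M.k → ℕ → M.Γ

/-- The symbol at position `p` of the input tape holding `w`. -/
def inputAt (w : List α) : ℕ → InputSymbol α
  | 0 => .leftEnd
  | i + 1 => match w[i]? with
    | some a => .letter a
    | none => .rightEnd

/-- The new position of the input head, which never leaves the part between the end markers. -/
def moveInput (w : List α) (p : ℕ) : HeadMove → ℕ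
  | .left => p - 1
  | .stay => p
  | .right => min (p + 1) (w.length + 1)

/-- The new position of a work head; a left move from the leftmost cell has no effect. -/
def moveWork (p : ℕ) : HeadMove → ℕ
  | .left => p - 1
  | .stay => p
  | .right => p + 1

/-- The initial configuration. -/
def init (M : OfflineTM α) : M.Config where
  state := M.start
  inputHead := 0
  workHead := fun _ => 0
  work := fun _ _ => M.blank

/-- One step of the computation on input `w`; `none` if the machine halts. -/
def step (M : OfflineTM α) (w : List α) (c : M.Config) : Option M.Config :=
  (M.δ c.state (inputAt w c.inputHead) (fun i => c.work i (c.workHead i))).map fun r =>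
    { state := r.1
      inputHead := moveInput w c.inputHead r.2.1
      workHead := fun i => moveWork (c.workHead i) (r.2.2 i).2
      work := fun i => Function.update (c.work i) (c.workHead i) (r.2.2 i).1 }

/-- `M` halts on every input, and accepts exactly the words of `L`. -/
def Decides (M : OfflineTM α) (L : Language α) : Prop :=
  ∀ w : List α, ∃ c ∈ StateTransition.eval (M.step w) M.init, (c.state ∈ M.accepting ↔ w ∈ L)

/-- On input `w`, each work head only visits the first `s` cells of its tape. -/
def UsesSpace (M : OfflineTM α) (w : List α) (s : ℕ) : Prop :=
  ∀ c, StateTransition.Reaches (M.step w) M.init c → ∀ i, c.workHead i < s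

end OfflineTM

/-- The languages decided in deterministic space `O(s(n) + 1)`. -/
def DSPACE (α : Type) (s : ℕ → ℕ) : Set (Language α) :=
  {L | ∃ M : OfflineTM α, M.Decides L ∧
    ∃ c : ℕ, ∀ w : List α, M.UsesSpace w (c * s w.length + c)}

/-- Deterministic logarithmic space. -/
def LogSPACE (α : Type) : Set (Language α) := DSPACE α (Nat.log 2)

/-! ### Alliances and token sliding -/

namespace AllianceReconf

section Graph

variable {V : Type*}

/-- `d_A(v)`, the number of neighbours of `v` in `A`. -/
noncomputable def degIn (G : SimpleGraph V) (A : Set V) (v : V) : ℕ :=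
  (G.neighborSet v ∩ A).ncard

/-- The boundary `N(A) \ A`. -/
def boundary (G : SimpleGraph V) (A : Set V) : Set V :=
  {v | ∃ u ∈ A, G.Adj u v} \ A

def IsOffensiveAlliance (G : SimpleGraph V) (A : Set V) : Prop :=
  ∀ v ∈ boundary G A, degIn G A v ≥ degIn G Aᶜ v + 1

def IsIndepOffensiveAlliance (G : SimpleGraph V) (A : Set V) : Prop :=
  IsOffensiveAlliance G A ∧ G.IsIndepSet A

def IsTokenJump (A B : Set V) : Prop :=
  A.ncard = B.ncard ∧ (A \ B).ncard = 1

def IsTokenSlide (G : SimpleGraph V) (A B : Set V) : Prop :=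
  IsTokenJump A B ∧ ∀ v ∈ A \ B, ∀ u ∈ B \ A, G.Adj v u

def IsLeaf (G : SimpleGraph V) (v : V) : Prop :=
  (G.neighborSet v).ncard = 1

/-- `{x, y}` is an edge connecting two leaves. -/
def IsIsolatedEdge (G : SimpleGraph V) (x y : V) : Prop :=
  G.Adj x y ∧ IsLeaf G x ∧ IsLeaf G y

/-- `l` is a sequence `As = A₁, …, A_ℓ = At` (with `ℓ = l.length`) of sets with property `X`,
consecutive ones being related by a step `Y`. -/
def IsReconfSeq (X : Set V → Prop) (Y : Set V → Set V → Prop) (As At : Set V)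
    (l : List (Set V)) : Prop :=
  l.head? = some As ∧ l.getLast? = some At ∧ l.IsChain Y ∧ ∀ A ∈ l, X A

end Graph

/-! ### The decision problems as formal languages -/

/-- The input alphabet: `some b` is the bit `b`, and `none` is a separator. -/
abbrev Letter := Option Bool

open Classical in
/-- The characteristic bit vector of a vertex set, followed by a separator. -/
noncomputable def encodeSet {n : ℕ} (A : Set (Fin n)) : List Letter :=
  (List.ofFn fun i => some (decide (i ∈ A))) ++ [none]

/-- The adjacency matrix, row by row. -/
noncomputable def encodeGraph {n : ℕ} (G : SimpleGraph (Fin n)) : List Letter :=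
  (List.ofFn fun i => encodeSet (G.neighborSet i)).flatten

/-- The encoding of an instance `(G, As, At)`. -/
noncomputable def encodeInstance {n : ℕ} (G : SimpleGraph (Fin n)) (As At : Set (Fin n)) :
    List Letter :=
  encodeGraph G ++ encodeSet As ++ encodeSet At

/-- The encoding of an instance `(G, As, At, T)`, with `T` in binary (least significant bit
first). -/
noncomputable def encodeTimedInstance {n : ℕ} (G : SimpleGraph (Fin n)) (As At : Set (Fin n))
    (T : ℕ) : List Letter :=
  encodeInstance G As At ++ (Nat.bits T).map some

/-- Independent Offensive Alliance Reconfiguration under token sliding: the encodings of its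
yes-instances. -/
def IdpOffReconfTS : Language Letter :=
  {w | ∃ (n : ℕ) (G : SimpleGraph (Fin n)) (As At : Set (Fin n)),
    w = encodeInstance G As At ∧
    IsIndepOffensiveAlliance G As ∧ IsIndepOffensiveAlliance G At ∧
    ∃ l, IsReconfSeq (IsIndepOffensiveAlliance G) (IsTokenSlide G) As At l}

/-- The timed version: the sequence `A₁, …, A_ℓ` has to satisfy `ℓ < T`. -/
def TimedIdpOffReconfTS : Language Letter :=
  {w | ∃ (n : ℕ) (G : SimpleGraph (Fin n)) (As At : Set (Fin n)) (T : ℕ),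
    w = encodeTimedInstance G As At T ∧
    IsIndepOffensiveAlliance G As ∧ IsIndepOffensiveAlliance G At ∧
    ∃ l, l.length < T ∧ IsReconfSeq (IsIndepOffensiveAlliance G) (IsTokenSlide G) As At l}

end AllianceReconf

/-! Suppose a token slides from `x` to `y`. Since `B` is independent and contains `y`, and `A \ B =
{x}`, the only neighbour of `y` in `A` is `x`. So `y` lies on the boundary of `A` with exactly one
neighbour inside, and the alliance inequality leaves none outside: `y` is a leaf
(`neighborSet_eq_singleton`). The reversed step gives the same for `x`, hence part (1),
`IsTokenSlide.isIsolatedEdge`.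

Tokens therefore only move along isolated edges, and conversely each such move preserves independent
offensive alliances (`slide_isIndepOffensiveAlliance`). A target is reachable exactly if the
vertices of the two symmetric differences are paired by isolated edges (`Matched`), and a shortest
sequence has `(A \ B).ncard + 1` members (`matched_of_isReconfSeq`,
`exists_isReconfSeq_of_matched`). The search over sequences becomes a condition built from bounded
quantifiers over vertices, degree counts and arithmetic.

To place such conditions in logarithmic space, `LogFun` collects the polynomially bounded functions
computed by register programs with polynomially bounded registers. It is closed under substitution
(`LogFun.cons_comp`) and under recursion with polynomially bounded values (`LogFun.primrec`), which
yields arithmetic, counting and bounded quantifiers. A register bounded by a polynomial is a binary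
counter of logarithmic length: `Cmd.Exec.exists_run` compiles programs to fragments with one counter
per work tape, and `Cmd.mem_logSPACE` turns these into a machine with the required space bound.

The bound `T` may be exponential in the length of the input, so it never enters a register;
`logPred_lt_lettersValue_drop` evaluates its digits only up to a small threshold. -/

/-! ### Machine fragments working on binary counters -/

/-- The work alphabet: a blank, a marker for the leftmost cell, and bits. -/
abbrev Cell := Option (Option Bool)

namespace Cell

abbrev blank : Cell := none
abbrev mark : Cell := some none
abbrev bit (b : Bool) : Cell := some (some b)

end Cell

/-- The contents of the tapes and the positions of the heads. -/
@[ext] structure TapeMemory (k : ℕ) where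
  inputHead : ℕ
  workHead : Fin k → ℕ
  work : Fin k → ℕ → Cell

/-- The effect of a transition on the tapes. -/
def TapeMemory.act {α : Type} {k : ℕ} (w : List α) (m : TapeMemory k)
    (r : HeadMove × (Fin k → Cell × HeadMove)) : TapeMemory k where
  inputHead := OfflineTM.moveInput w m.inputHead r.1
  workHead := fun i => OfflineTM.moveWork (m.workHead i) (r.2 i).2
  work := fun i => Function.update (m.work i) (m.workHead i) (r.2 i).1

/-- A piece of a machine, with one entry `start` and one exit, represented by `none`. -/
structure Fragment (α : Type) (k : ℕ) where
  Q : Type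
  finite_Q : Finite Q
  start : Q
  δ : Q → InputSymbol α → (Fin k → Cell) → Option Q × HeadMove × (Fin k → Cell × HeadMove)

namespace Fragment

variable {α : Type} {k : ℕ}

/-- The transition applied in state `q` with memory `m`. -/
def trans (F : Fragment α k) (w : List α) (q : F.Q) (m : TapeMemory k) :
    Option F.Q × HeadMove × (Fin k → Cell × HeadMove) :=
  F.δ q (OfflineTM.inputAt w m.inputHead) (fun i => m.work i (m.workHead i))

/-- `F.Run w S q m m'`: started in `q` with memory `m`, the fragment reaches its exit with memory
`m'`, and all memories before the exit satisfy `S`. -/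
inductive Run (F : Fragment α k) (w : List α) (S : TapeMemory k → Prop) :
    Option F.Q → TapeMemory k → TapeMemory k → Prop
  | done (m) : Run F w S none m m
  | step {q m m'} : S m → Run F w S (F.trans w q m).1 (m.act w (F.trans w q m).2) m' →
      Run F w S (some q) m m'

/-- `F` is part of `F'`, with the exit of `F` leading to `cont`. -/
def Embeds (F F' : Fragment α k) (ι : F.Q → F'.Q) (cont : Option F'.Q) : Prop :=
  ∀ q x y, F'.δ (ι q) x y = ((F.δ q x y).1.elim cont (fun q => some (ι q)), (F.δ q x y).2)

/-- An embedded fragment makes the moves of `F` with only its exit redirected, so its run can be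
glued to any run from `cont`. Sequences, loops and conditionals all reduce to this gluing. -/
theorem Run.embed {F F' : Fragment α k} {w : List α} {S : TapeMemory k → Prop}
    {ι : F.Q → F'.Q} {cont : Option F'.Q} (h : F.Embeds F' ι cont) {q m m' m''}
    (h₁ : F.Run w S q m m') (h₂ : F'.Run w S cont m' m'') :
    F'.Run w S (q.elim cont (fun q => some (ι q))) m m'' := by
  induction h₁ with
  | done m => exact h₂
  | @step q m m' hS _ ih =>
    refine Run.step hS ?_
    have : F'.trans w (ι q) m
        = ((F.trans w q m).1.elim cont (fun q => some (ι q)), (F.trans w q m).2) := h _ _ _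
    rw [this]
    exact ih h₂

/-- Write `c` on tape `i` and move its head by `d`. -/
def writeTape (i : Fin k) (y : Fin k → Cell) (c : Cell) (d : HeadMove) : Fin k → Cell × HeadMove :=
  fun j => if j = i then (c, d) else (y j, .stay)

/-- Leave the work tapes as they are. -/
def idleTapes (y : Fin k → Cell) : Fin k → Cell × HeadMove := fun j => (y j, .stay)

/-- Increment the counter on tape `i`: carry to the right, then go back to the marker. -/
def inc (i : Fin k) : Fragment α k where
  Q := Bool
  finite_Q := inferInstance
  start := false
  δ q _ y := match q, y i with
    | false, some none => (some false, .stay, writeTape i y Cell.mark .right)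
    | false, some (some true) => (some false, .stay, writeTape i y (Cell.bit false) .right)
    | false, _ => (some true, .stay, writeTape i y (Cell.bit true) .left)
    | true, some none => (none, .stay, idleTapes y)
    | true, c => (some true, .stay, writeTape i y c .left)

/-- Move the input head. -/
def move (d : HeadMove) : Fragment α k where
  Q := Unit
  finite_Q := inferInstance
  start := ()
  δ _ _ y := (none, d, idleTapes y)

/-- Sequential composition. -/
def seq (F G : Fragment α k) : Fragment α k where
  Q := F.Q ⊕ G.Q
  finite_Q := by have := F.finite_Q; have := G.finite_Q; infer_instance
  start := .inl F.start
  δ q x y := match q with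
    | .inl q => ((F.δ q x y).1.elim (some (.inr G.start)) (fun q => some (.inl q)), (F.δ q x y).2)
    | .inr q => ((G.δ q x y).1.elim none (fun q => some (.inr q)), (G.δ q x y).2)

/-- While the counter on tape `i` is positive, decrement it and run `F`. In state `none` the
borrow moves to the right, in state `some true` the head returns after a successful decrement, and
in state `some false` it returns and restores the zeros. -/
def loop (i : Fin k) (F : Fragment α k) : Fragment α k where
  Q := Option Bool ⊕ F.Q
  finite_Q := by have := F.finite_Q; infer_instance
  start := .inl none
  δ q x y := match q with
    | .inl none => match y i with
      | some none => (some (.inl none), .stay, writeTape i y Cell.mark .right)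
      | some (some false) => (some (.inl none), .stay, writeTape i y (Cell.bit true) .right)
      | some (some true) => (some (.inl (some true)), .stay, writeTape i y (Cell.bit false) .left)
      | none => (some (.inl (some false)), .stay, writeTape i y Cell.blank .left)
    | .inl (some true) => match y i with
      | some none => (some (.inr F.start), .stay, idleTapes y)
      | c => (some (.inl (some true)), .stay, writeTape i y c .left)
    | .inl (some false) => match y i with
      | some none => (none, .stay, idleTapes y)
      | _ => (some (.inl (some false)), .stay, writeTape i y (Cell.bit false) .left)
    | .inr q => ((F.δ q x y).1.elim (some (.inl none)) (fun q => some (.inr q)), (F.δ q x y).2)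

/-- Run `F` if the scanned input symbol satisfies `P`. -/
def cond (P : InputSymbol α → Bool) (F : Fragment α k) : Fragment α k where
  Q := Unit ⊕ F.Q
  finite_Q := by have := F.finite_Q; infer_instance
  start := .inl ()
  δ q x y := match q with
    | .inl _ => (bif P x then some (.inr F.start) else none, .stay, idleTapes y)
    | .inr q => ((F.δ q x y).1.elim none (fun q => some (.inr q)), (F.δ q x y).2)

/-- Run `F` as long as the scanned input symbol satisfies `P`. -/
def whileSymbol (P : InputSymbol α → Bool) (F : Fragment α k) : Fragment α k where
  Q := Unit ⊕ F.Q
  finite_Q := by have := F.finite_Q; infer_instance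
  start := .inl ()
  δ q x y := match q with
    | .inl _ => (bif P x then some (.inr F.start) else none, .stay, idleTapes y)
    | .inr q => ((F.δ q x y).1.elim (some (.inl ())) (fun q => some (.inr q)), (F.δ q x y).2)

theorem embeds_seq_left (F G : Fragment α k) :
    F.Embeds (F.seq G) Sum.inl (some (.inr G.start)) := fun _ _ _ => rfl

theorem embeds_seq_right (F G : Fragment α k) : G.Embeds (F.seq G) Sum.inr none :=
  fun _ _ _ => rfl

theorem embeds_loop (i : Fin k) (F : Fragment α k) :
    F.Embeds (loop i F) Sum.inr (some (.inl none)) := fun _ _ _ => rfl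

theorem embeds_cond (P : InputSymbol α → Bool) (F : Fragment α k) :
    F.Embeds (cond P F) Sum.inr none := fun _ _ _ => rfl

theorem embeds_whileSymbol (P : InputSymbol α → Bool) (F : Fragment α k) :
    F.Embeds (whileSymbol P F) Sum.inr (some (.inl ())) := fun _ _ _ => rfl

end Fragment

/-! ### Binary counters on tapes -/

/-- The number with the given binary digits, least significant digit first. -/
def bitsValue : List Bool → ℕ
  | [] => 0
  | b :: l => b.toNat + 2 * bitsValue l

/-- The tape holding a marker followed by the given bits. -/
def counterTape (l : List Bool) : ℕ → Cell
  | 0 => Cell.mark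
  | j + 1 => (l[j]?).map some

theorem bitsValue_replicate_false_append (j : ℕ) (l : List Bool) :
    bitsValue (List.replicate j false ++ l) = 2 ^ j * bitsValue l := by
  induction j with
  | zero => simp
  | succ j ih => simp [List.replicate_succ, bitsValue, ih, pow_succ]; ring

/-- A block of `j` ones is worth `2 ^ j - 1`. Together with the value of a block of zeros this is
the arithmetic of carries and borrows, which exchange the two blocks. -/
theorem bitsValue_replicate_true_append (j : ℕ) (l : List Bool) :
    bitsValue (List.replicate j true ++ l) + 1 = 2 ^ j * (bitsValue l + 1) := by
  induction j with
  | zero => simp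
  | succ j ih =>
    simp only [List.replicate_succ, List.cons_append, bitsValue, Bool.toNat_true, pow_succ]
    linarith

theorem counterTape_append_cons (a b : List Bool) (x : Bool) :
    counterTape (a ++ x :: b) (a.length + 1) = Cell.bit x := by
  simp [counterTape]

theorem counterTape_length_add_one (a : List Bool) :
    counterTape a (a.length + 1) = Cell.blank := by
  simp [counterTape]

theorem update_counterTape_append_cons (a b : List Bool) (x y : Bool) :
    Function.update (counterTape (a ++ x :: b)) (a.length + 1) (Cell.bit y)
      = counterTape (a ++ y :: b) := by
  funext j
  rcases j with _ | j
  · simp [counterTape]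
  · by_cases h : j = a.length
    · subst h; simp [counterTape]
    · rw [Function.update_of_ne (by omega)]
      simp only [counterTape, List.getElem?_append]
      split
      · rfl
      · obtain ⟨t, ht⟩ : ∃ t, j - a.length = t + 1 := ⟨j - a.length - 1, by omega⟩
        simp [ht]

theorem update_counterTape_length (a : List Bool) (y : Bool) :
    Function.update (counterTape a) (a.length + 1) (Cell.bit y) = counterTape (a ++ [y]) := by
  funext j
  rcases j with _ | j
  · simp [counterTape]
  · by_cases h : j = a.length
    · subst h; simp [counterTape]
    · rw [Function.update_of_ne (by omega)]
      simp only [counterTape, List.getElem?_append]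
      split
      · rfl
      · rw [List.getElem?_eq_none (by omega), List.getElem?_eq_none (by simp; omega)]

theorem exists_counterTape_add_one {l : List Bool} {h : ℕ} (hh : h < l.length) :
    ∃ b, counterTape l (h + 1) = Cell.bit b := by
  simp [counterTape, hh]

/-- The memory with the input head at `p`, the work heads at `h` and counters `l`. -/
def counterMemory {k : ℕ} (p : ℕ) (h : Fin k → ℕ) (l : Fin k → List Bool) : TapeMemory k where
  inputHead := p
  workHead := h
  work := fun i => counterTape (l i)

/-! ### Correctness of the increment and of the counted loop -/

namespace Fragment

variable {α : Type} {k : ℕ}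

/-- The other tapes rewrite the symbol they scan, so the memory keeps its counter form as soon as
the tape `i` does. -/
theorem act_writeTape (w : List α) (p : ℕ) (h : Fin k → ℕ) (l : Fin k → List Bool) (i : Fin k)
    (c : Cell) (d : HeadMove) (l' : List Bool)
    (hc : Function.update (counterTape (l i)) (h i) c = counterTape l') :
    (counterMemory p h l).act w (.stay, writeTape i (fun j => counterTape (l j) (h j)) c d)
      = counterMemory p (Function.update h i (OfflineTM.moveWork (h i) d))
          (Function.update l i l') := by
  ext j
  · rfl
  · by_cases hj : j = i
    · subst hj; simp [TapeMemory.act, counterMemory, writeTape]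
    · simp [TapeMemory.act, counterMemory, writeTape, hj, OfflineTM.moveWork]
  · by_cases hj : j = i
    · subst hj; simp [TapeMemory.act, counterMemory, writeTape, hc]
    · simp [TapeMemory.act, counterMemory, writeTape, hj]

theorem act_idleTapes (w : List α) (p : ℕ) (h : Fin k → ℕ) (l : Fin k → List Bool)
    (d : HeadMove) :
    (counterMemory p h l).act w (d, idleTapes (fun j => counterTape (l j) (h j)))
      = counterMemory (OfflineTM.moveInput w p d) h l := by
  ext j
  · rfl
  · simp [TapeMemory.act, counterMemory, idleTapes, OfflineTM.moveWork]
  · simp [TapeMemory.act, counterMemory, idleTapes]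

/-- All work heads are at positions below `s`. -/
def HeadsBelow (s : ℕ) (m : TapeMemory k) : Prop := ∀ i, m.workHead i < s

/-- One step of a fragment that changes one tape only. -/
theorem Run.step_writeTape {F : Fragment α k} {w : List α} {s p : ℕ} {i : Fin k} {h : ℕ}
    {l : Fin k → List Bool} {q : F.Q} {q' : Option F.Q} {c : Cell} {d : HeadMove}
    {x l' : List Bool} {m' : TapeMemory k} (hs : h < s)
    (hδ : ∀ sym y, y i = counterTape x h → F.δ q sym y = (q', .stay, writeTape i y c d))
    (hc : Function.update (counterTape x) h c = counterTape l')
    (hr : F.Run w (HeadsBelow s) q'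
      (counterMemory p (Function.update 0 i (OfflineTM.moveWork h d)) (Function.update l i l')) m') :
    F.Run w (HeadsBelow s) (some q)
      (counterMemory p (Function.update 0 i h) (Function.update l i x)) m' := by
  refine Run.step ?_ ?_
  · intro j
    by_cases hj : j = i
    · subst hj; simpa [counterMemory] using hs
    · simp [counterMemory, hj]; omega
  · have : F.trans w q (counterMemory p (Function.update 0 i h) (Function.update l i x))
        = (q', .stay, writeTape i (fun j => counterTape (Function.update l i x j)
            ((Function.update 0 i h : Fin k → ℕ) j)) c d) := by
      apply hδ
      simp [counterMemory]
    rw [this]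
    simp only
    rw [act_writeTape (l' := l') (hc := by simpa using hc)]
    simpa using hr

/-- One step of a fragment, with all heads on the markers, that changes no work tape. -/
theorem Run.step_idleTapes {F : Fragment α k} {w : List α} {s p : ℕ}
    {l : Fin k → List Bool} {q : F.Q} {q' : Option F.Q} {d : HeadMove}
    {m' : TapeMemory k} (hs : 0 < s)
    (hδ : ∀ y, (∀ i, y i = Cell.mark) →
      F.δ q (OfflineTM.inputAt w p) y = (q', d, idleTapes y))
    (hr : F.Run w (HeadsBelow s) q' (counterMemory (OfflineTM.moveInput w p d) 0 l) m') :
    F.Run w (HeadsBelow s) (some q) (counterMemory p 0 l) m' := by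
  refine Run.step (fun _ => hs) ?_
  have : F.trans w q (counterMemory p 0 l)
      = (q', d, idleTapes (fun j => counterTape (l j) ((0 : Fin k → ℕ) j))) := hδ _ fun _ => rfl
  rw [this]
  simp only
  rwa [act_idleTapes]

theorem inc_return {w : List α} {s p : ℕ} {i : Fin k} {l : Fin k → List Bool} {x : List Bool}
    (h : ℕ) (hx : h ≤ x.length) (hs : h < s) :
    (inc i : Fragment α k).Run w (HeadsBelow s) (some true)
      (counterMemory p (Function.update 0 i h) (Function.update l i x))
      (counterMemory p 0 (Function.update l i x)) := by
  induction h with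
  | zero =>
    have : (Function.update (0 : Fin k → ℕ) i 0) = 0 := by simp
    rw [this]
    refine Run.step_idleTapes (q' := none) (d := .stay) hs (fun y hy => ?_) (Run.done _)
    simp [inc, hy]
  | succ h ih =>
    obtain ⟨b, hb⟩ := exists_counterTape_add_one (l := x) (h := h) (by omega)
    refine Run.step_writeTape (q' := some true) (c := Cell.bit b) (d := .left) (l' := x) hs
      (fun sym y hy => ?_) ?_ ?_
    · rw [hb] at hy; simp [inc, hy]
    · rw [← hb]; simp
    · exact ih (by omega) (by omega)

/-- Invariant of the carry: the first `j` digits were ones and have become zeros, and `y` is still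
unread. A digit is appended only if every digit was a one, and then the new value is exactly a power
of two; this is what keeps counters logarithmically short. -/
theorem inc_carry {w : List α} {s p : ℕ} {i : Fin k} {l : Fin k → List Bool} {L : ℕ}
    (hs : L + 1 < s) (y : List Bool) (j : ℕ) (hL : j + y.length ≤ L) :
    ∃ z : List Bool, bitsValue z = bitsValue (List.replicate j true ++ y) + 1 ∧
      (z.length = j + y.length ∨
        z.length = j + y.length + 1 ∧ bitsValue z = 2 ^ (j + y.length)) ∧
    (inc i : Fragment α k).Run w (HeadsBelow s) (some false)
      (counterMemory p (Function.update 0 i (j + 1))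
        (Function.update l i (List.replicate j false ++ y)))
      (counterMemory p 0 (Function.update l i z)) := by
  have hlen : (List.replicate j false).length + 1 = j + 1 := by simp
  induction y generalizing j with
  | nil =>
    refine ⟨List.replicate j false ++ [true], ?_, Or.inr ⟨by simp, ?_⟩, ?_⟩
    · rw [bitsValue_replicate_true_append, bitsValue_replicate_false_append]
      simp [bitsValue]
    · rw [bitsValue_replicate_false_append]
      simp [bitsValue]
    · refine Run.step_writeTape (q' := some true) (c := Cell.bit true) (d := .left)
        (l' := List.replicate j false ++ [true]) (by simp at hL; omega)
        (fun sym y hy => ?_) ?_ ?_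
      · have := counterTape_length_add_one (List.replicate j false)
        rw [hlen] at this
        rw [List.append_nil, this] at hy
        simp [inc, hy]
      · have := update_counterTape_length (List.replicate j false) true
        rw [hlen] at this
        simpa using this
      · exact inc_return _ (by simp [OfflineTM.moveWork])
          (by simp at hL; simp [OfflineTM.moveWork]; omega)
  | cons b y ih =>
    have hL' : j + y.length + 1 ≤ L := by simp at hL; omega
    have hcell := counterTape_append_cons (List.replicate j false) y b
    have hupd := fun c => update_counterTape_append_cons (List.replicate j false) y b c
    rw [hlen] at hcell
    simp only [hlen] at hupd
    cases b with
    | false =>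
      refine ⟨List.replicate j false ++ true :: y, ?_, Or.inl (by simp), ?_⟩
      · rw [bitsValue_replicate_true_append, bitsValue_replicate_false_append]
        simp [bitsValue]; ring
      · refine Run.step_writeTape (q' := some true) (c := Cell.bit true) (d := .left)
          (l' := List.replicate j false ++ true :: y) (by omega)
          (fun sym y hy => ?_) (hupd true) ?_
        · rw [hcell] at hy
          simp [inc, hy]
        · exact inc_return _ (by simp [OfflineTM.moveWork])
            (by simp [OfflineTM.moveWork]; omega)
    | true =>
      obtain ⟨z, hz, hz', hr⟩ := ih (j + 1) (by omega) (by simp)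
      have e1 : ∀ c, List.replicate j c ++ c :: y = List.replicate (j + 1) c ++ y := by
        intro c; simp [List.replicate_succ', List.append_assoc]
      refine ⟨z, by rw [hz, e1], ?_, ?_⟩
      · simp only [List.length_cons]
        rw [show j + (y.length + 1) = j + 1 + y.length by omega]
        exact hz'
      · refine Run.step_writeTape (q' := some false) (c := Cell.bit false) (d := .right)
          (l' := List.replicate (j + 1) false ++ y) (by omega)
          (fun sym y hy => ?_) (by rw [hupd false, e1]) hr
        rw [hcell] at hy
        simp [inc, hy]

theorem loop_return {F : Fragment α k} {w : List α} {s p : ℕ} {i : Fin k} {l : Fin k → List Bool}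
    {x : List Bool} {m' : TapeMemory k} (h : ℕ) (hx : h ≤ x.length) (hs : h < s)
    (hr : (loop i F).Run w (HeadsBelow s) (some (.inr F.start))
      (counterMemory p 0 (Function.update l i x)) m') :
    (loop i F).Run w (HeadsBelow s) (some (.inl (some true)))
      (counterMemory p (Function.update 0 i h) (Function.update l i x)) m' := by
  induction h with
  | zero =>
    have : (Function.update (0 : Fin k → ℕ) i 0) = 0 := by simp
    rw [this]
    refine Run.step_idleTapes (F := loop i F) (q' := some (Sum.inr F.start)) (d := .stay) hs (fun y hy => ?_) hr
    simp [loop, hy]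
  | succ h ih =>
    obtain ⟨b, hb⟩ := exists_counterTape_add_one (l := x) (h := h) (by omega)
    refine Run.step_writeTape (F := loop i F) (q' := some (Sum.inl (some true))) (c := Cell.bit b) (d := .left)
      (l' := x) hs (fun sym y hy => ?_) ?_ ?_
    · rw [hb] at hy; simp [loop, hy]
    · rw [← hb]; simp
    · exact ih (by omega) (by omega)

/-- On the way back, `h` ones left by the failed borrow remain to be reset and `j` zeros are already
restored. -/
theorem loop_restore {F : Fragment α k} {w : List α} {s p : ℕ} {i : Fin k} {l : Fin k → List Bool}
    (h j : ℕ) (hs : h < s) :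
    (loop i F).Run w (HeadsBelow s) (some (.inl (some false)))
      (counterMemory p (Function.update 0 i h)
        (Function.update l i (List.replicate h true ++ List.replicate j false)))
      (counterMemory p 0 (Function.update l i (List.replicate (h + j) false))) := by
  induction h generalizing j with
  | zero =>
    have : (Function.update (0 : Fin k → ℕ) i 0) = 0 := by simp
    rw [this]
    refine Run.step_idleTapes (q' := none) (d := .stay) hs (fun y hy => ?_) ?_
    · simp [loop, hy]
    · simpa [OfflineTM.moveInput] using Run.done _
  | succ h ih =>
    have e1 : List.replicate (h + 1) true ++ List.replicate j false
        = List.replicate h true ++ true :: List.replicate j false := by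
      simp [List.replicate_succ', List.append_assoc]
    have hcell := counterTape_append_cons (List.replicate h true) (List.replicate j false) true
    have hupd := update_counterTape_append_cons (List.replicate h true) (List.replicate j false)
      true false
    rw [List.length_replicate] at hcell hupd
    rw [e1]
    refine Run.step_writeTape (F := loop i F) (q' := some (Sum.inl (some false))) (c := Cell.bit false) (d := .left)
      (l' := List.replicate h true ++ List.replicate (j + 1) false) hs (fun sym y hy => ?_)
      hupd ?_
    · rw [hcell] at hy; simp [loop, hy]
    · have := ih (j + 1) (by omega)
      rwa [show h + (j + 1) = h + 1 + j by omega] at this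

/-- At value zero the borrow turns every zero into a one until it meets the blank, which reveals the
underflow; the zeros are then restored and the loop is left. -/
theorem loop_borrow_zero {F : Fragment α k} {w : List α} {s p : ℕ} {i : Fin k}
    {l : Fin k → List Bool} (n j : ℕ) (hs : j + n + 1 < s) :
    (loop i F).Run w (HeadsBelow s) (some (.inl none))
      (counterMemory p (Function.update 0 i (j + 1))
        (Function.update l i (List.replicate j true ++ List.replicate n false)))
      (counterMemory p 0 (Function.update l i (List.replicate (j + n) false))) := by
  induction n generalizing j with
  | zero =>
    refine Run.step_writeTape (F := loop i F) (q' := some (Sum.inl (some false))) (c := Cell.blank) (d := .left)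
      (l' := List.replicate j true ++ List.replicate 0 false) (by omega) (fun sym y hy => ?_) ?_ ?_
    · have := counterTape_length_add_one (List.replicate j true)
      rw [List.length_replicate] at this
      rw [List.replicate_zero, List.append_nil, this] at hy
      simp [loop, hy]
    · have := counterTape_length_add_one (List.replicate j true)
      rw [List.length_replicate] at this
      rw [List.replicate_zero, List.append_nil, ← this]
      simp
    · exact loop_restore j 0 (by omega)
  | succ n ih =>
    have e1 : List.replicate (j + 1) true ++ List.replicate n false
        = List.replicate j true ++ true :: List.replicate n false := by
      simp [List.replicate_succ', List.append_assoc]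
    have hcell := counterTape_append_cons (List.replicate j true) (List.replicate n false) false
    have hupd := update_counterTape_append_cons (List.replicate j true) (List.replicate n false)
      false true
    rw [List.length_replicate] at hcell hupd
    refine Run.step_writeTape (F := loop i F) (q' := some (Sum.inl none)) (c := Cell.bit true) (d := .right)
      (l' := List.replicate (j + 1) true ++ List.replicate n false) (by omega)
      (fun sym y hy => ?_) (by rw [e1]; exact hupd) ?_
    · rw [List.replicate_succ, hcell] at hy; simp [loop, hy]
    · have := ih (j + 1) (by omega)
      rwa [show j + 1 + n = j + (n + 1) by omega] at this

/-- A nonzero counter contains a one, where the borrow stops. Leading zeros are kept, so the length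
does not change. The run is stated relative to a continuation because the loop goes on with its
body. -/
theorem loop_borrow_succ {F : Fragment α k} {w : List α} {s p : ℕ} {i : Fin k}
    {l : Fin k → List Bool} {L : ℕ} (hs : L + 1 < s) (y : List Bool) (j : ℕ)
    (hL : j + y.length ≤ L) (hy : bitsValue y ≠ 0) :
    ∃ z : List Bool, bitsValue z + 1 = bitsValue (List.replicate j false ++ y) ∧
      z.length = j + y.length ∧ ∀ m',
    (loop i F).Run w (HeadsBelow s) (some (.inr F.start))
      (counterMemory p 0 (Function.update l i z)) m' →
    (loop i F).Run w (HeadsBelow s) (some (.inl none))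
      (counterMemory p (Function.update 0 i (j + 1))
        (Function.update l i (List.replicate j true ++ y))) m' := by
  have hlen : (List.replicate j true).length + 1 = j + 1 := by simp
  induction y generalizing j with
  | nil => simp [bitsValue] at hy
  | cons b y ih =>
    have hL' : j + y.length + 1 ≤ L := by simp at hL; omega
    have hcell := counterTape_append_cons (List.replicate j true) y b
    have hupd := fun c => update_counterTape_append_cons (List.replicate j true) y b c
    rw [hlen] at hcell
    simp only [hlen] at hupd
    cases b with
    | true =>
      refine ⟨List.replicate j true ++ false :: y, ?_, by simp, fun m' hr => ?_⟩
      · rw [bitsValue_replicate_true_append, bitsValue_replicate_false_append]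
        simp [bitsValue]; ring
      · refine Run.step_writeTape (F := loop i F) (q' := some (Sum.inl (some true))) (c := Cell.bit false) (d := .left)
          (l' := List.replicate j true ++ false :: y) (by omega)
          (fun sym y hy => ?_) (hupd false) ?_
        · rw [hcell] at hy
          simp [loop, hy]
        · exact loop_return _ (by simp [OfflineTM.moveWork])
            (by simp [OfflineTM.moveWork]; omega) hr
    | false =>
      obtain ⟨z, hz, hz', hr⟩ := ih (j + 1) (by omega) (by simpa [bitsValue] using hy) (by simp)
      have e1 : ∀ c, List.replicate j c ++ c :: y = List.replicate (j + 1) c ++ y := by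
        intro c; simp [List.replicate_succ', List.append_assoc]
      refine ⟨z, by rw [hz, e1], by simp [hz']; omega, fun m' h => ?_⟩
      refine Run.step_writeTape (F := loop i F) (q' := some (Sum.inl none)) (c := Cell.bit true) (d := .right)
        (l' := List.replicate (j + 1) true ++ y) (by omega)
        (fun sym y hy => ?_) (by rw [hupd true, e1]) (hr m' h)
      rw [hcell] at hy
      simp [loop, hy]

theorem eq_replicate_of_bitsValue_eq_zero {x : List Bool} (h : bitsValue x = 0) :
    x = List.replicate x.length false := by
  induction x with
  | nil => rfl
  | cons b x ih =>
    simp only [bitsValue, Nat.add_eq_zero_iff, mul_eq_zero, OfNat.ofNat_ne_zero, false_or] at h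
    have hb : b = false := by simpa using h.1
    rw [hb, List.length_cons, List.replicate_succ]
    exact congrArg _ (ih h.2)

theorem run_inc {w : List α} {s p : ℕ} {i : Fin k} {l : Fin k → List Bool}
    (hs : (l i).length + 1 < s) :
    ∃ z : List Bool, bitsValue z = bitsValue (l i) + 1 ∧
      (z.length = (l i).length ∨ z.length = (l i).length + 1 ∧ bitsValue z = 2 ^ (l i).length) ∧
    (inc i : Fragment α k).Run w (HeadsBelow s) (some (inc (α := α) i).start)
      (counterMemory p 0 l) (counterMemory p 0 (Function.update l i z)) := by
  obtain ⟨z, h1, h2, h3⟩ := inc_carry (w := w) (p := p) (i := i) (l := l) hs (l i) 0 (by simp)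
  refine ⟨z, by simpa using h1, by simpa using h2, ?_⟩
  have := Run.step_writeTape (F := (inc i : Fragment α k)) (q := false) (q' := some false)
    (h := 0) (i := i) (s := s) (w := w) (p := p) (l := l)
    (m' := counterMemory p 0 (Function.update l i z))
    (c := Cell.mark) (d := .right) (x := l i) (l' := l i) (hs := by omega)
    (fun sym y hy => by simp [inc, hy, counterTape]) (by simp [counterTape])
    (by simpa [OfflineTM.moveWork] using h3)
  simpa [inc] using this

theorem run_loop_zero {F : Fragment α k} {w : List α} {s p : ℕ} {i : Fin k}
    {l : Fin k → List Bool} (hs : (l i).length + 1 < s) (h0 : bitsValue (l i) = 0) :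
    (loop i F).Run w (HeadsBelow s) (some (loop i F).start)
      (counterMemory p 0 l) (counterMemory p 0 l) := by
  have hx := eq_replicate_of_bitsValue_eq_zero h0
  have h3 := loop_borrow_zero (F := F) (w := w) (s := s) (p := p) (i := i) (l := l)
    (l i).length 0 (by omega)
  simp only [List.replicate_zero, List.nil_append, zero_add, ← hx, Function.update_eq_self] at h3
  have := Run.step_writeTape (F := loop i F) (q := Sum.inl none) (q' := some (Sum.inl none)) (h := 0) (i := i)
    (s := s) (w := w) (p := p) (l := l) (m' := counterMemory p 0 l)
    (c := Cell.mark) (d := .right) (x := l i) (l' := l i) (hs := by omega)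
    (fun sym y hy => by simp [loop, hy, counterTape]) (by simp [counterTape])
    (by simpa [OfflineTM.moveWork] using h3)
  simpa [loop] using this

theorem run_loop_succ {F : Fragment α k} {w : List α} {s p : ℕ} {i : Fin k}
    {l : Fin k → List Bool} (hs : (l i).length + 1 < s) (h0 : bitsValue (l i) ≠ 0) :
    ∃ z : List Bool, bitsValue z + 1 = bitsValue (l i) ∧ z.length = (l i).length ∧
      ∀ m' m'', F.Run w (HeadsBelow s) (some F.start)
        (counterMemory p 0 (Function.update l i z)) m' →
      (loop i F).Run w (HeadsBelow s) (some (loop i F).start) m' m'' →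
      (loop i F).Run w (HeadsBelow s) (some (loop i F).start) (counterMemory p 0 l) m'' := by
  obtain ⟨z, h1, h2, h3⟩ := loop_borrow_succ (F := F) (w := w) (p := p) (i := i) (l := l) hs
    (l i) 0 (by simp) h0
  refine ⟨z, by simpa using h1, by simpa using h2, fun m' m'' hF hr => ?_⟩
  have h4 := h3 m'' (hF.embed (embeds_loop i F) hr)
  have := Run.step_writeTape (F := loop i F) (q := Sum.inl none) (q' := some (Sum.inl none)) (h := 0) (i := i)
    (s := s) (w := w) (p := p) (l := l) (m' := m'')
    (c := Cell.mark) (d := .right) (x := l i) (l' := l i) (hs := by omega)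
    (fun sym y hy => by simp [loop, hy, counterTape]) (by simp [counterTape])
    (by simpa [OfflineTM.moveWork] using h4)
  simpa [loop] using this

end Fragment

/-! ### Register programs -/

/-- Programs with an input head and registers holding natural numbers. The program `loop r c` runs
`c` after each successful decrement of the register `r`. -/
inductive Cmd (α : Type) where
  | inc (r : ℕ)
  | move (d : HeadMove)
  | seq (c d : Cmd α)
  | loop (r : ℕ) (c : Cmd α)
  | cond (P : InputSymbol α → Bool) (c : Cmd α)
  | whileSymbol (P : InputSymbol α → Bool) (c : Cmd α)

namespace Cmd

variable {α : Type}

/-- All registers of the program have an index at most `K`. -/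
def RegsLE (K : ℕ) : Cmd α → Prop
  | inc r => r ≤ K
  | move _ => True
  | seq c d => c.RegsLE K ∧ d.RegsLE K
  | loop r c => r ≤ K ∧ c.RegsLE K
  | cond _ c => c.RegsLE K
  | whileSymbol _ c => c.RegsLE K

theorem RegsLE.mono {K L : ℕ} (h : K ≤ L) {c : Cmd α} (hc : c.RegsLE K) : c.RegsLE L := by
  induction c with
  | inc r => exact le_trans hc h
  | move d => trivial
  | seq c d ihc ihd => exact ⟨ihc hc.1, ihd hc.2⟩
  | loop r c ih => exact ⟨le_trans hc.1 h, ih hc.2⟩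
  | cond P c ih => exact ih hc
  | whileSymbol P c ih => exact ih hc

theorem exists_regsLE (c : Cmd α) : ∃ K, c.RegsLE K := by
  induction c with
  | inc r => exact ⟨r, le_refl r⟩
  | move d => exact ⟨0, trivial⟩
  | seq c d ihc ihd =>
    obtain ⟨K, hK⟩ := ihc
    obtain ⟨L, hL⟩ := ihd
    exact ⟨max K L, hK.mono (le_max_left _ _), hL.mono (le_max_right _ _)⟩
  | loop r c ih =>
    obtain ⟨K, hK⟩ := ih
    exact ⟨max r K, le_max_left _ _, hK.mono (le_max_right _ _)⟩
  | cond P c ih => exact ih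
  | whileSymbol P c ih => exact ih

/-- `Exec w B c σ τ`: on input `w`, the program `c` started with input head position `σ.1` and
registers `σ.2` halts in `τ`, and no register is incremented beyond `B`. -/
inductive Exec (w : List α) (B : ℕ) : Cmd α → ℕ × (ℕ → ℕ) → ℕ × (ℕ → ℕ) → Prop
  | inc {r p s} : s r + 1 ≤ B → Exec w B (.inc r) (p, s) (p, Function.update s r (s r + 1))
  | move {d p s} : Exec w B (.move d) (p, s) (OfflineTM.moveInput w p d, s)
  | seq {c d σ τ υ} : Exec w B c σ τ → Exec w B d τ υ → Exec w B (.seq c d) σ υ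
  | loop_zero {r c p s} : s r = 0 → Exec w B (.loop r c) (p, s) (p, s)
  | loop_succ {r c p s n τ υ} : s r = n + 1 → Exec w B c (p, Function.update s r n) τ →
      Exec w B (.loop r c) τ υ → Exec w B (.loop r c) (p, s) υ
  | cond_true {P c p s τ} : P (OfflineTM.inputAt w p) = true → Exec w B c (p, s) τ →
      Exec w B (.cond P c) (p, s) τ
  | cond_false {P c p s} : P (OfflineTM.inputAt w p) = false →
      Exec w B (.cond P c) (p, s) (p, s)
  | while_true {P c p s τ υ} : P (OfflineTM.inputAt w p) = true → Exec w B c (p, s) τ →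
      Exec w B (.whileSymbol P c) τ υ → Exec w B (.whileSymbol P c) (p, s) υ
  | while_false {P c p s} : P (OfflineTM.inputAt w p) = false →
      Exec w B (.whileSymbol P c) (p, s) (p, s)

theorem Exec.mono {w : List α} {B C : ℕ} (h : B ≤ C) {c : Cmd α} {σ τ} (hc : Exec w B c σ τ) :
    Exec w C c σ τ := by
  induction hc with
  | inc h' => exact .inc (h'.trans h)
  | move => exact .move
  | seq _ _ ih₁ ih₂ => exact .seq ih₁ ih₂
  | loop_zero h' => exact .loop_zero h'
  | loop_succ h' _ _ ih₁ ih₂ => exact .loop_succ h' ih₁ ih₂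
  | cond_true h' _ ih => exact .cond_true h' ih
  | cond_false h' => exact .cond_false h'
  | while_true h' _ _ ih₁ ih₂ => exact .while_true h' ih₁ ih₂
  | while_false h' => exact .while_false h'

/-- The fragment with `K + 1` work tapes that executes a program. -/
def toFragment (K : ℕ) : Cmd α → Fragment α (K + 1)
  | inc r => Fragment.inc (Fin.ofNat (K + 1) r)
  | move d => Fragment.move d
  | seq c d => (c.toFragment K).seq (d.toFragment K)
  | loop r c => Fragment.loop (Fin.ofNat (K + 1) r) (c.toFragment K)
  | cond P c => Fragment.cond P (c.toFragment K)
  | whileSymbol P c => Fragment.whileSymbol P (c.toFragment K)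

/-- The memory `m` represents the state `σ`, with counters of a length suitable for the bound
`B`. -/
def Represents (B : ℕ) {K : ℕ} (m : TapeMemory (K + 1)) (σ : ℕ × (ℕ → ℕ)) : Prop :=
  ∃ l : Fin (K + 1) → List Bool, m = counterMemory σ.1 0 l ∧
    ∀ i, bitsValue (l i) = σ.2 i ∧ 2 ^ (l i).length ≤ 2 * B

/-- `Fin.ofNat` reduces modulo `K + 1`; up to `K` this is harmless, so distinct registers have
distinct tapes. -/
theorem ofNat_val {K r : ℕ} (h : r ≤ K) : ((Fin.ofNat (K + 1) r : Fin (K + 1)) : ℕ) = r := by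
  simp [Fin.ofNat, Nat.mod_eq_of_lt (Nat.lt_succ_of_le h)]

theorem represents_update {B K p r n : ℕ} {s : ℕ → ℕ} {l : Fin (K + 1) → List Bool}
    {z : List Bool} (hr : r ≤ K) (hl : ∀ i, bitsValue (l i) = s i ∧ 2 ^ (l i).length ≤ 2 * B)
    (hz : bitsValue z = n) (hz' : 2 ^ z.length ≤ 2 * B) :
    Represents B (counterMemory p 0 (Function.update l (Fin.ofNat (K + 1) r) z))
      (p, Function.update s r n) := by
  refine ⟨_, rfl, fun j => ?_⟩
  by_cases hj : j = Fin.ofNat (K + 1) r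
  · have : (j : ℕ) = r := by rw [hj, ofNat_val hr]
    rw [hj]
    simp only [Function.update_self]
    rw [← hj, this]
    simp [hz, hz']
  · have : (j : ℕ) ≠ r := fun h => hj (Fin.ext (by rw [h, ofNat_val hr]))
    rw [Function.update_of_ne hj]
    simp only [Function.update_of_ne this]
    exact hl j

/-- The space sufficient for counters up to `B`. -/
def counterSpace (B : ℕ) : ℕ := Nat.log 2 (2 * B) + 2

theorem length_lt_counterSpace {B L : ℕ} (h : 2 ^ L ≤ 2 * B) : L + 1 < counterSpace B := by
  have := Nat.le_log_of_pow_le (by norm_num) h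
  simp only [counterSpace]
  omega

-- Compilation is correct by induction on the execution. Only an increment can lengthen a counter,
-- so the length invariant of `Represents` has to be rechecked only there.
open Fragment in
theorem Exec.exists_run {w : List α} {B K : ℕ} {c : Cmd α} {σ τ} (h : Exec w B c σ τ)
    (hc : c.RegsLE K) (m : TapeMemory (K + 1)) (hm : Represents B m σ) :
    ∃ m', Represents B m' τ ∧ (c.toFragment K).Run w (HeadsBelow (counterSpace B))
      (some (c.toFragment K).start) m m' := by
  induction h generalizing m with
  | @inc r p s h' =>
    obtain ⟨l, rfl, hl⟩ := hm
    obtain ⟨z, h1, h2, h3⟩ := run_inc (α := α) (w := w) (p := p) (i := Fin.ofNat (K + 1) r)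
      (length_lt_counterSpace (hl _).2)
    have h4 := (hl (Fin.ofNat (K + 1) r)).1
    have h5 := (hl (Fin.ofNat (K + 1) r)).2
    rw [ofNat_val hc] at h4
    dsimp only at h4
    refine ⟨_, represents_update hc hl (by rw [h1, h4]) ?_, h3⟩
    rcases h2 with h2 | ⟨h2, h2'⟩
    · rwa [h2]
    -- The counter has grown, so its new value is `2 ^ (l i).length`. Doubling it gives `2 ^
    -- z.length`, and the value is at most `B`; hence the bound `2 * B` rather than `B`.
    · rw [h2, pow_succ, ← h2', h1, h4]
      omega
  | @move d p s =>
    obtain ⟨l, rfl, hl⟩ := hm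
    exact ⟨_, ⟨l, rfl, hl⟩, Run.step_idleTapes (by simp [counterSpace])
      (fun _ _ => rfl) (Run.done _)⟩
  | seq _ _ ih₁ ih₂ =>
    obtain ⟨m₁, h₁, r₁⟩ := ih₁ hc.1 m hm
    obtain ⟨m₂, h₂, r₂⟩ := ih₂ hc.2 m₁ h₁
    exact ⟨m₂, h₂, r₁.embed (embeds_seq_left _ _) (r₂.embed (embeds_seq_right _ _) (Run.done _))⟩
  | @loop_zero r c p s h' =>
    obtain ⟨l, rfl, hl⟩ := hm
    refine ⟨_, ⟨l, rfl, hl⟩, run_loop_zero (length_lt_counterSpace (hl _).2) ?_⟩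
    rw [(hl _).1, ofNat_val hc.1]
    exact h'
  | @loop_succ r c p s n τ υ h' _ _ ih₁ ih₂ =>
    obtain ⟨l, rfl, hl⟩ := hm
    have h4 := (hl (Fin.ofNat (K + 1) r)).1
    rw [ofNat_val hc.1] at h4
    dsimp only at h4
    obtain ⟨z, h1, h2, h3⟩ := run_loop_succ (F := c.toFragment K) (w := w) (p := p)
      (length_lt_counterSpace (hl (Fin.ofNat (K + 1) r)).2) (by rw [h4, h']; simp)
    obtain ⟨m₁, h₁, r₁⟩ := ih₁ hc.2 _ (represents_update (p := p) (z := z) hc.1 hl (by omega)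
      (by rw [h2]; exact (hl _).2))
    obtain ⟨m₂, h₂, r₂⟩ := ih₂ hc m₁ h₁
    exact ⟨m₂, h₂, h3 m₁ m₂ r₁ r₂⟩
  | @cond_true P c p s τ h' _ ih =>
    obtain ⟨m₁, h₁, r₁⟩ := ih hc m hm
    refine ⟨m₁, h₁, ?_⟩
    obtain ⟨l, rfl, hl⟩ := hm
    exact Run.step_idleTapes (F := Fragment.cond P (c.toFragment K)) (d := .stay)
      (by simp [counterSpace]) (q' := some (Sum.inr _))
      (fun _ _ => by simp [toFragment, Fragment.cond, h']) (r₁.embed (embeds_cond _ _) (Run.done _))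
  | @cond_false P c p s h' =>
    obtain ⟨l, rfl, hl⟩ := hm
    exact ⟨_, ⟨l, rfl, hl⟩, Run.step_idleTapes (F := Fragment.cond P (c.toFragment K))
      (d := .stay) (by simp [counterSpace]) (q' := none)
      (fun _ _ => by simp [toFragment, Fragment.cond, h']) (Run.done _)⟩
  | @while_true P c p s τ υ h' _ _ ih₁ ih₂ =>
    obtain ⟨m₁, h₁, r₁⟩ := ih₁ hc m hm
    obtain ⟨m₂, h₂, r₂⟩ := ih₂ hc m₁ h₁
    refine ⟨m₂, h₂, ?_⟩
    obtain ⟨l, rfl, hl⟩ := hm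
    exact Run.step_idleTapes (F := Fragment.whileSymbol P (c.toFragment K)) (d := .stay)
      (by simp [counterSpace]) (q' := some (Sum.inr _))
      (fun _ _ => by simp [toFragment, Fragment.whileSymbol, h']) (r₁.embed (embeds_whileSymbol _ _) r₂)
  | @while_false P c p s h' =>
    obtain ⟨l, rfl, hl⟩ := hm
    exact ⟨_, ⟨l, rfl, hl⟩, Run.step_idleTapes (F := Fragment.whileSymbol P (c.toFragment K))
      (d := .stay) (by simp [counterSpace]) (q' := none)
      (fun _ _ => by simp [toFragment, Fragment.whileSymbol, h']) (Run.done _)⟩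

end Cmd

/-! ### From fragments to machines -/

namespace OfflineTM

variable {α : Type}

/-- The computation from the given configuration halts in a configuration that satisfies `P`, and
all its configurations satisfy `S`. -/
inductive HaltsWith (M : OfflineTM α) (w : List α) (S P : M.Config → Prop) : M.Config → Prop
  | halt {c} : M.step w c = none → S c → P c → HaltsWith M w S P c
  | next {c c'} : M.step w c = some c' → S c → HaltsWith M w S P c' → HaltsWith M w S P c

theorem HaltsWith.exists_mem_eval {M : OfflineTM α} {w : List α} {S P : M.Config → Prop}
    {c : M.Config} (h : M.HaltsWith w S P c) :
    ∃ c' ∈ StateTransition.eval (M.step w) c, P c' := by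
  induction h with
  | @halt c h _ hP =>
    exact ⟨c, StateTransition.mem_eval.2 ⟨Relation.ReflTransGen.refl, h⟩, hP⟩
  | @next c c' h _ _ ih =>
    obtain ⟨d, hd, hP⟩ := ih
    rw [StateTransition.mem_eval] at hd
    exact ⟨d, StateTransition.mem_eval.2 ⟨Relation.ReflTransGen.head h hd.1, hd.2⟩, hP⟩

/-- The machine is deterministic, so every reachable configuration lies on the one halting
computation. -/
theorem HaltsWith.of_reaches {M : OfflineTM α} {w : List α} {S P : M.Config → Prop}
    {c d : M.Config} (h : M.HaltsWith w S P c) (hd : StateTransition.Reaches (M.step w) c d) :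
    S d := by
  induction h with
  | @halt c h hS _ =>
    rcases Relation.ReflTransGen.cases_head hd with rfl | ⟨e, he, _⟩
    · exact hS
    · simp [h] at he
  | @next c c' h hS _ ih =>
    rcases Relation.ReflTransGen.cases_head hd with rfl | ⟨e, he, hr⟩
    · exact hS
    · rw [h, Option.mem_def, Option.some_inj] at he
      subst he
      exact ih hr

end OfflineTM

namespace Fragment

variable {α : Type} {k : ℕ}

/-- The machine that marks the leftmost cells, runs `F`, and accepts if the counter on tape `o` is
odd. The states `0`, `1` and `2` are for the set-up and for the two steps of the final check. -/
def toTM (F : Fragment α k) (o : Fin k) : OfflineTM α where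
  Q := F.Q ⊕ Fin 3 ⊕ Bool
  finite_Q := by have := F.finite_Q; infer_instance
  Γ := Cell
  finite_Γ := inferInstance
  blank := Cell.blank
  k := k
  start := .inr (.inl 0)
  accepting := {.inr (.inr true)}
  δ q x y := match q with
    | .inl q => some ((F.δ q x y).1.elim (.inr (.inl 1)) Sum.inl, (F.δ q x y).2)
    | .inr (.inl 0) => some (.inl F.start, .stay, fun _ => (Cell.mark, .stay))
    | .inr (.inl 1) => some (.inr (.inl 2), .stay, writeTape o y (y o) .right)
    | .inr (.inl 2) => some (.inr (.inr (decide (y o = Cell.bit true))), .stay, idleTapes y)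
    | .inr (.inr _) => none

/-- The configuration of the machine in the given state with the given memory. -/
def config (F : Fragment α k) (o : Fin k) (q : (F.toTM o).Q) (m : TapeMemory k) :
    (F.toTM o).Config where
  state := q
  inputHead := m.inputHead
  workHead := m.workHead
  work := m.work

theorem Run.haltsWith {F : Fragment α k} {o : Fin k} {w : List α} {S : TapeMemory k → Prop}
    {P : (F.toTM o).Config → Prop} {q m m'} (h : F.Run w S q m m')
    (hP : (F.toTM o).HaltsWith w (fun c => S ⟨c.inputHead, c.workHead, c.work⟩) P
      (F.config o (.inr (.inl 1)) m')) :
    (F.toTM o).HaltsWith w (fun c => S ⟨c.inputHead, c.workHead, c.work⟩) P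
      (F.config o (q.elim (.inr (.inl 1)) Sum.inl) m) := by
  induction h with
  | done m => exact hP
  | @step q m m' hS _ ih => exact .next (c' := F.config o _ _) rfl hS (ih hP)

/-- Acceptance by parity needs only the least significant digit, whatever the leading zeros; an
empty counter shows a blank there and has value zero. -/
theorem bitsValue_odd_iff (l : List Bool) :
    counterTape l 1 = Cell.bit true ↔ bitsValue l % 2 = 1 := by
  rcases l with _ | ⟨b, l⟩
  · simp [counterTape, bitsValue]
  · cases b <;> simp [counterTape, bitsValue, Nat.add_mod]

theorem toTM_haltsWith {F : Fragment α k} {o : Fin k} {w : List α} {s p : ℕ}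
    {l : Fin k → List Bool} (hs : 1 < s)
    (h : F.Run w (HeadsBelow s) (some F.start) (counterMemory 0 0 fun _ => [])
      (counterMemory p 0 l)) :
    (F.toTM o).HaltsWith w (fun c => ∀ i, c.workHead i < s)
      (fun c => c.state ∈ (F.toTM o).accepting ↔ bitsValue (l o) % 2 = 1) (F.toTM o).init := by
  -- A blank tape with its first cell marked is the counter without digits, so the set-up step makes
  -- every register zero.
  have hinit : (F.toTM o).step w (F.toTM o).init
      = some (F.config o (.inl F.start) (counterMemory 0 0 fun _ => [])) := by
    simp only [OfflineTM.step, OfflineTM.init, toTM, config, counterMemory, Option.map_some,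
      OfflineTM.moveInput, OfflineTM.moveWork]
    congr
    funext i j
    rcases j with _ | j <;> simp [counterTape]
  refine .next hinit (fun i => by simp [OfflineTM.init]; omega) (Run.haltsWith h ?_)
  set m₁ := counterMemory p (Function.update 0 o 1) l with hm₁
  have e₁ : (F.toTM o).step w (F.config o (.inr (.inl 1)) (counterMemory p 0 l))
      = some (F.config o (.inr (.inl 2)) m₁) := by
    have := act_writeTape w p 0 l o (counterTape (l o) 0) .right (l o) (by simp)
    simp only [Function.update_eq_self] at this
    exact congrArg (fun m => some (F.config o (.inr (.inl 2)) m)) this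
  have e₂ : (F.toTM o).step w (F.config o (.inr (.inl 2)) m₁)
      = some (F.config o (.inr (.inr (decide (counterTape (l o) 1 = Cell.bit true)))) m₁) := by
    have h₁ := act_idleTapes w p (Function.update 0 o 1) l .stay
    have h₂ : counterTape (l o) (m₁.workHead o) = counterTape (l o) 1 := by
      simp [hm₁, counterMemory]
    rw [← h₂]
    exact congrArg (fun m => some (F.config o (.inr (.inr (decide
      (counterTape (l o) (m₁.workHead o) = Cell.bit true)))) m)) h₁
  have hb : ∀ i, m₁.workHead i < s := by
    intro i
    by_cases hi : i = o
    · subst hi; simpa [hm₁, counterMemory] using hs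
    · simp [hm₁, counterMemory, hi]; omega
  refine .next e₁ (fun i => by simp [counterMemory, config]; omega) (.next e₂ hb (.halt rfl hb ?_))
  have hacc : ∀ b : Bool, (Sum.inr (Sum.inr b) : F.Q ⊕ Fin 3 ⊕ Bool) ∈
      ({Sum.inr (Sum.inr true)} : Set (F.Q ⊕ Fin 3 ⊕ Bool)) ↔ b = true := by simp
  exact (hacc _).trans (by rw [decide_eq_true_eq, bitsValue_odd_iff])

end Fragment

/-- Registers below a fixed power of the input length need counters of length proportional to its
logarithm, and an execution provides both termination and the space bound. -/
theorem Cmd.mem_logSPACE {α : Type} {L : Language α} (c : Cmd α) (o e : ℕ)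
    (f : List α → ℕ) (hf : ∀ w, f w % 2 = 1 ↔ w ∈ L)
    (hc : ∀ w, ∃ p s, Exec w ((w.length + 2) ^ e) c (0, 0) (p, s) ∧ s o = f w) :
    L ∈ LogSPACE α := by
  obtain ⟨K₀, hK₀⟩ := c.exists_regsLE
  obtain ⟨K, hK, hoK⟩ : ∃ K, c.RegsLE K ∧ o ≤ K :=
    ⟨max K₀ o, hK₀.mono (le_max_left _ _), le_max_right _ _⟩
  have key : ∀ w, ((c.toFragment K).toTM (Fin.ofNat (K + 1) o)).HaltsWith w
      (fun d => ∀ i, d.workHead i < counterSpace ((w.length + 2) ^ e))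
      (fun d => d.state ∈ ((c.toFragment K).toTM (Fin.ofNat (K + 1) o)).accepting ↔ w ∈ L)
      ((c.toFragment K).toTM (Fin.ofNat (K + 1) o)).init := by
    intro w
    obtain ⟨p, s, hs, ho⟩ := hc w
    obtain ⟨m', ⟨l, rfl, hl⟩, hr⟩ := hs.exists_run hK (counterMemory 0 0 fun _ => [])
      ⟨_, rfl, fun i => ⟨rfl, by
        have : 0 < (w.length + 2) ^ e := by positivity
        simp; omega⟩⟩
    have := Fragment.toTM_haltsWith (o := Fin.ofNat (K + 1) o) (by simp [counterSpace]) hr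
    rw [(hl _).1, ofNat_val hoK, show (p, s).2 o = f w from ho, hf] at this
    exact this
  -- The space is at most `(Nat.log 2 w.length + 2) * e + 1`, plus the `2` from `counterSpace`; its
  -- constant term is `2 * e + 3`.
  refine ⟨_, fun w => (key w).exists_mem_eval, 2 * e + 3, fun w d hd i => ?_⟩
  refine ((key w).of_reaches hd i).trans_le ?_
  have h1 : w.length + 2 ≤ 2 ^ (Nat.log 2 w.length + 2) := by
    have := Nat.lt_pow_succ_log_self (b := 2) (by norm_num) w.length
    have h2 : 1 ≤ 2 ^ Nat.log 2 w.length := Nat.one_le_two_pow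
    rw [pow_succ] at this ⊢
    rw [pow_succ]
    omega
  have h2 : 2 * (w.length + 2) ^ e ≤ 2 ^ (1 + (Nat.log 2 w.length + 2) * e) := by
    rw [pow_add, pow_one, pow_mul]
    exact Nat.mul_le_mul_left _ (Nat.pow_le_pow_left h1 e)
  have h3 := Nat.log_mono_right (b := 2) h2
  rw [Nat.log_pow (by norm_num)] at h3
  simp only [counterSpace]
  nlinarith [Nat.zero_le (Nat.log 2 w.length), Nat.zero_le e]

/-! ### Functions computable by register programs with polynomially bounded registers -/

namespace Cmd

variable {α : Type} {w : List α} {B : ℕ}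

/-- Loop invariant: `S j` is the state before pass `j`. The body starts with `r` already decremented
and has to end with that same value in `r`. -/
theorem Exec.loop_iterate {r : ℕ} {c : Cmd α} (n : ℕ) (S : ℕ → ℕ × (ℕ → ℕ))
    (hr : ∀ j ≤ n, (S j).2 r = n - j)
    (h : ∀ j < n, Exec w B c ((S j).1, Function.update (S j).2 r (n - (j + 1))) (S (j + 1))) :
    Exec w B (loop r c) (S 0) (S n) := by
  suffices ∀ m j, j + m = n → Exec w B (loop r c) (S j) (S n) from this n 0 (by omega)
  intro m
  induction m with
  | zero =>
    intro j hj
    obtain rfl : j = n := by omega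
    exact .loop_zero (by rw [hr j le_rfl]; omega)
  | succ m ih =>
    intro j hj
    exact .loop_succ (n := n - (j + 1)) (by rw [hr j (by omega)]; omega) (h j (by omega))
      (ih (j + 1) (by omega))

/-- Do nothing. -/
def skip : Cmd α := move .stay

theorem exec_skip {p : ℕ} {s : ℕ → ℕ} : Exec w B skip (p, s) (p, s) :=
  Exec.move (w := w) (B := B) (d := .stay)

/-- Set a register to zero. -/
def clear (r : ℕ) : Cmd α := loop r skip

theorem exec_clear {r p : ℕ} {s : ℕ → ℕ} :
    Exec w B (clear r) (p, s) (p, Function.update s r 0) := by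
  have := Exec.loop_iterate (w := w) (B := B) (r := r) (c := skip) (s r)
    (fun j => (p, Function.update s r (s r - j))) (by simp)
    (fun j _ => by simpa using exec_skip)
  simpa [clear] using this

/-- Add the register `r` to the register `o` and set `r` to zero. -/
def transfer (r o : ℕ) : Cmd α := loop r (inc o)

theorem exec_transfer {r o p : ℕ} {s : ℕ → ℕ} (h : r ≠ o) (hB : s o + s r ≤ B) :
    Exec w B (transfer r o) (p, s)
      (p, Function.update (Function.update s o (s o + s r)) r 0) := by
  have := Exec.loop_iterate (w := w) (B := B) (r := r) (c := inc o) (s r)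
    (fun j => (p, Function.update (Function.update s o (s o + j)) r (s r - j))) (by simp)
    (fun j hj => by
      have := Exec.inc (w := w) (B := B) (r := o) (p := p)
        (s := Function.update (Function.update s o (s o + j)) r (s r - (j + 1)))
        (by simp [h.symm]; omega)
      convert this using 2
      · simp
      · funext i
        simp only [Function.update_apply]
        split_ifs <;> grind)
  simpa [transfer] using this

/-- Add the register `r` to the register `o`, using the register `t` with value zero. -/
def copy (r o t : ℕ) : Cmd α := seq (loop r (seq (inc o) (inc t))) (transfer t r)

theorem exec_copy {r o t p : ℕ} {s : ℕ → ℕ} (hro : r ≠ o) (hrt : r ≠ t) (hot : o ≠ t)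
    (ht : s t = 0) (hB : s o + s r ≤ B) :
    Exec w B (copy r o t) (p, s) (p, Function.update s o (s o + s r)) := by
  have h₁ := Exec.loop_iterate (w := w) (B := B) (r := r) (c := seq (inc o) (inc t)) (s r)
    (fun j => (p, Function.update (Function.update (Function.update s o (s o + j)) t j)
      r (s r - j))) (by simp)
    (fun j hj => by
      have e₁ := Exec.inc (w := w) (B := B) (r := o) (p := p)
        (s := Function.update (Function.update (Function.update s o (s o + j)) t j)
          r (s r - (j + 1))) (by simp [hro.symm, hot]; omega)
      refine Exec.seq (by simpa using e₁) ?_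
      have e₂ := Exec.inc (w := w) (B := B) (r := t) (p := p)
        (s := Function.update (Function.update (Function.update (Function.update s o (s o + j)) t j)
          r (s r - (j + 1))) o (s o + j + 1)) (by simp [hrt.symm, hot.symm]; omega)
      convert e₂ using 2
      · simp [hro.symm, hot]
      · funext i
        simp only [Function.update_apply]
        split_ifs <;> grind)
  -- Since `t` is zero at the start, the invariant begins at `s` itself; after the loop `t` holds
  -- the old value of `r`, ready to be moved back.
  have hs₀ : Function.update (Function.update (Function.update s o (s o + 0)) t 0) r (s r - 0)
      = s := by
    have : Function.update s t 0 = s := by rw [← ht]; simp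
    simp [this]
  simp only [hs₀, Nat.sub_self] at h₁
  refine Exec.seq h₁ ?_
  have h₂ := exec_transfer (w := w) (B := B) (p := p) (r := t) (o := r)
    (s := Function.update (Function.update (Function.update s o (s o + s r)) t (s r)) r 0)
    hrt.symm (by simp [hrt.symm]; omega)
  convert h₂ using 2
  funext i
  simp only [Function.update_apply]
  split_ifs <;> grind

/-- Move the input head to the left end marker. -/
def rewind : Cmd α := whileSymbol (fun x => match x with | .leftEnd => false | _ => true)
  (move .left)

theorem exec_rewind {p : ℕ} {s : ℕ → ℕ} : Exec w B rewind (p, s) (0, s) := by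
  induction p with
  | zero => exact .while_false rfl
  | succ p ih =>
    refine .while_true ?_ .move ih
    simp only [OfflineTM.inputAt]
    cases w[p]? <;> rfl

end Cmd

section LogFun

open Cmd

variable {α : Type} {k : ℕ}

/-- `f` is polynomially bounded in terms of the length of the input word and the arguments, and
it is computed by register programs with polynomially bounded registers: for every choice `a` of
the argument registers and of a result register `o`, and every bound `b` beyond which all registers
may be used as auxiliary registers. -/
def LogFun (f : List α → (Fin k → ℕ) → ℕ) : Prop :=
  ∃ e : ℕ,
    (∀ w v N, w.length ≤ N → (∀ i, v i ≤ N) → f w v ≤ (N + 2) ^ e) ∧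
    ∀ (b o : ℕ) (a : Fin k → ℕ), (∀ i, a i < b ∧ a i ≠ o) → o < b → ∃ c : Cmd α,
      ∀ w N s, w.length ≤ N → (∀ i, s (a i) ≤ N) → s o = 0 → (∀ i, b ≤ i → s i = 0) →
        Exec w ((N + 2) ^ e) c (0, s) (0, Function.update s o (f w fun i => s (a i)))

/-- Polynomial boundedness, as required of recursively defined functions. -/
def PolyBounded (f : List α → (Fin k → ℕ) → ℕ) : Prop :=
  ∃ e : ℕ, ∀ w v N, w.length ≤ N → (∀ i, v i ≤ N) → f w v ≤ (N + 2) ^ e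

theorem LogFun.polyBounded {f : List α → (Fin k → ℕ) → ℕ} (hf : LogFun f) : PolyBounded f :=
  let ⟨e, h, _⟩ := hf; ⟨e, h⟩

theorem pow_bound_mono {N e e' : ℕ} (h : e ≤ e') : (N + 2) ^ e ≤ (N + 2) ^ e' :=
  Nat.pow_le_pow_right (by omega) h

theorem le_pow_bound {N e : ℕ} (h : 1 ≤ e) : N + 2 ≤ (N + 2) ^ e := by
  simpa using pow_bound_mono (N := N) h

/-- Polynomial bounds compose: one more factor `N + 2` absorbs the added `2`. The inner exponent is
`e + 1` so that the inner bound also dominates `N`. -/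
theorem pow_bound_comp (N e e' : ℕ) : ((N + 2) ^ (e + 1) + 2) ^ e' ≤ (N + 2) ^ ((e + 2) * e') := by
  rw [pow_mul]
  refine Nat.pow_le_pow_left ?_ _
  have h1 := le_pow_bound (N := N) (e := e + 1) (by omega)
  rw [pow_succ (N + 2) (e + 1)]
  nlinarith

/-! ### Basic functions, substitution and bounded recursion -/

namespace LogFun

theorem zero : LogFun (fun (_ : List α) (_ : Fin k → ℕ) => 0) := by
  refine ⟨0, by simp, fun b o a _ _ => ⟨skip, fun w N s _ _ ho _ => ?_⟩⟩
  have : Function.update s o 0 = s := by rw [← ho]; simp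
  rw [this]
  exact exec_skip

theorem succ {f : List α → (Fin k → ℕ) → ℕ} (hf : LogFun f) : LogFun (fun w v => f w v + 1) := by
  obtain ⟨e, hb, hc⟩ := hf
  have key : ∀ N, (N + 2) ^ e + 1 ≤ (N + 2) ^ (e + 1) := by
    intro N
    have : 1 ≤ (N + 2) ^ e := Nat.one_le_pow _ _ (by omega)
    rw [pow_succ]
    nlinarith
  refine ⟨e + 1, fun w v N hw hv => (Nat.succ_le_succ (hb w v N hw hv)).trans (key N),
    fun b o a ha ho => ?_⟩
  obtain ⟨c, hc⟩ := hc b o a ha ho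
  refine ⟨seq c (.inc o), fun w N s hw hs hso hsb => ?_⟩
  refine Exec.seq ((hc w N s hw hs hso hsb).mono (pow_bound_mono (by omega))) ?_
  have := Exec.inc (w := w) (B := (N + 2) ^ (e + 1)) (p := 0) (r := o)
    (s := Function.update s o (f w fun i => s (a i)))
    (by simpa using (Nat.succ_le_succ (hb w _ N hw hs)).trans (key N))
  simpa using this

theorem var (i : Fin k) : LogFun (fun (_ : List α) v => v i) := by
  refine ⟨1, fun w v N _ hv => (hv i).trans (by simp), fun b o a ha ho => ?_⟩
  refine ⟨copy (a i) o b, fun w N s _ hs hso hsb => ?_⟩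
  have := exec_copy (w := w) (B := (N + 2) ^ 1) (p := 0) (s := s) (ha i).2
    (ne_of_lt (ha i).1) (ne_of_lt ho) (hsb b le_rfl) (by rw [hso, pow_one]; have := hs i; omega)
  simpa [hso] using this

theorem rename {l : ℕ} {f : List α → (Fin k → ℕ) → ℕ} (hf : LogFun f) (ρ : Fin k → Fin l) :
    LogFun (fun w (v : Fin l → ℕ) => f w fun i => v (ρ i)) := by
  obtain ⟨e, hb, hc⟩ := hf
  refine ⟨e, fun w v N hw hv => hb w _ N hw fun i => hv _, fun b o a ha ho => ?_⟩
  obtain ⟨c, hc⟩ := hc b o (fun i => a (ρ i)) (fun i => ha _) ho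
  exact ⟨c, fun w N s hw hs => hc w N s hw fun i => hs _⟩

/-- The value of `g` is kept in the auxiliary register `b`, used as the first argument of `f`, and
cleared afterwards; both programs take their auxiliary registers from `b + 1` on. -/
theorem cons_comp {g : List α → (Fin k → ℕ) → ℕ} {f : List α → (Fin (k + 1) → ℕ) → ℕ}
    (hf : LogFun f) (hg : LogFun g) : LogFun (fun w v => f w (Fin.cons (g w v) v)) := by
  obtain ⟨e, hb, hc⟩ := hf
  obtain ⟨e', hb', hc'⟩ := hg
  have hN : ∀ w v N, w.length ≤ N → (∀ i, v i ≤ N) →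
      ∀ i, (Fin.cons (g w v) v : Fin (k + 1) → ℕ) i ≤ (N + 2) ^ (e' + 1) := by
    intro w v N hw hv i
    refine Fin.cases ?_ (fun i => ?_) i
    · exact (hb' w v N hw hv).trans (pow_bound_mono (by omega))
    · exact (hv i).trans (le_trans (by omega) (le_pow_bound (N := N) (e := e' + 1) (by omega)))
  have hw' : ∀ {w : List α} {N : ℕ}, w.length ≤ N → w.length ≤ (N + 2) ^ (e' + 1) :=
    fun {w N} h => h.trans (le_trans (by omega) (le_pow_bound (N := N) (e := e' + 1) (by omega)))
  refine ⟨(e' + 2) * e + e', fun w v N hw hv => ?_, fun b o a ha ho => ?_⟩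
  · exact ((hb w _ _ (hw' hw) (hN w v N hw hv)).trans (pow_bound_comp N e' e)).trans
      (pow_bound_mono (by omega))
  · obtain ⟨c, hc⟩ := hc (b + 1) o (Fin.cons b a) (fun i => by
      refine Fin.cases (by simp; omega) (fun i => ?_) i
      simpa using ⟨(ha i).1.le, (ha i).2⟩) (by omega)
    obtain ⟨c', hc'⟩ := hc' (b + 1) b a (fun i => ⟨(ha i).1.trans (by omega), (ha i).1.ne⟩)
      (by omega)
    refine ⟨seq c' (seq c (clear b)), fun w N s hw hs hso hsb => ?_⟩
    set v : Fin k → ℕ := fun i => s (a i) with hv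
    have hargs : (fun i => Function.update s b (g w v) ((Fin.cons b a : Fin (k + 1) → ℕ) i))
        = (Fin.cons (g w v) v : Fin (k + 1) → ℕ) := by
      funext i
      refine Fin.cases (by simp) (fun i => ?_) i
      simp [(ha i).1.ne, hv]
    refine Exec.seq ((hc' w N s hw hs (hsb b le_rfl) fun i hi => hsb i (by omega)).mono
      (pow_bound_mono (by omega))) ?_
    have h₁ : Exec w ((N + 2) ^ ((e' + 2) * e + e')) c (0, Function.update s b (g w v))
        (0, Function.update (Function.update s b (g w v)) o (f w (Fin.cons (g w v) v))) := by
      have := hc w ((N + 2) ^ (e' + 1)) (Function.update s b (g w v)) (hw' hw)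
        (fun i => by rw [congrFun hargs i]; exact hN w v N hw hs i)
        (by rw [Function.update_of_ne ho.ne]; exact hso)
        (fun i hi => by rw [Function.update_of_ne (by omega)]; exact hsb i (by omega))
      rw [hargs] at this
      exact this.mono ((pow_bound_comp N e' e).trans (pow_bound_mono (by omega)))
    convert h₁.seq exec_clear using 2
    funext i
    have := hsb b le_rfl
    simp only [Function.update_apply]
    split_ifs <;> grind

/-- The recursion is run by a counted loop that stores only the current value. Every value up to the
last index must be polynomially bounded, since each passes through a register; hence the hypothesis
on the whole course of `R`. -/
theorem primrec {n g : List α → (Fin k → ℕ) → ℕ} {h : List α → (Fin (k + 2) → ℕ) → ℕ}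
    (R : List α → (Fin k → ℕ) → ℕ → ℕ)
    (hn : LogFun n) (hg : LogFun g) (hh : LogFun h)
    (hR₀ : ∀ w v, R w v 0 = g w v)
    (hR : ∀ w v j, R w v (j + 1) = h w (Fin.cons j (Fin.cons (R w v j) v)))
    (hRb : ∃ e : ℕ, ∀ w v N, w.length ≤ N → (∀ i, v i ≤ N) → ∀ j ≤ n w v,
      R w v j ≤ (N + 2) ^ e) :
    LogFun (fun w v => R w v (n w v)) := by
  obtain ⟨en, hbn, hcn⟩ := hn
  obtain ⟨eg, hbg, hcg⟩ := hg
  obtain ⟨eh, hbh, hch⟩ := hh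
  obtain ⟨er, hbr⟩ := hRb
  -- `(N + 2) ^ (E + 1)` bounds all arguments of the step function: the index, the current value and
  -- the parameters.
  set E := en + er with hE
  set T := en + eg + er + (E + 2) * eh + 1 with hT
  have hNle : ∀ N, N ≤ (N + 2) ^ (E + 1) := fun N =>
    le_trans (by omega) (le_pow_bound (N := N) (e := E + 1) (by omega))
  refine ⟨T, fun w v N hw hv => (hbr w v N hw hv _ le_rfl).trans (pow_bound_mono (by omega)),
    fun b o a ha ho => ?_⟩
  obtain ⟨cn, hcn⟩ := hcn (b + 3) b a (fun i => ⟨(ha i).1.trans (by omega), (ha i).1.ne⟩)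
    (by omega)
  obtain ⟨cg, hcg⟩ := hcg (b + 3) (b + 2) a
    (fun i => ⟨(ha i).1.trans (by omega), by have := (ha i).1; omega⟩) (by omega)
  obtain ⟨ch, hch⟩ := hch (b + 3) o (Fin.cons (b + 1) (Fin.cons (b + 2) a)) (fun i => by
    refine Fin.cases ⟨by simp, by simp; omega⟩ (fun i => ?_) i
    refine Fin.cases ⟨by simp, by simp; omega⟩ (fun i => ?_) i
    simpa using ⟨(ha i).1.trans (by omega), (ha i).2⟩) (by omega)
  -- Register `b` counts the remaining passes, `b + 1` holds the index and `b + 2` the current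
  -- value. The step writes to `o`, because its result register must start at zero and differ from
  -- its arguments; the result is then moved to `b + 2`.
  refine ⟨seq cn (seq cg (seq (loop b (seq ch (seq (clear (b + 2)) (seq (transfer o (b + 2))
    (Cmd.inc (b + 1)))))) (seq (clear (b + 1)) (transfer (b + 2) o)))),
    fun w N s hw hs hso hsb => ?_⟩
  set v : Fin k → ℕ := fun i => s (a i) with hv
  set m := n w v with hm
  let S : ℕ → ℕ × (ℕ → ℕ) := fun j => (0, Function.update (Function.update (Function.update s
    b (m - j)) (b + 1) j) (b + 2) (R w v j))
  have hb0 := hsb b le_rfl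
  have hb1 := hsb (b + 1) (by omega)
  have hb2 := hsb (b + 2) (by omega)
  have hrb : ∀ j ≤ m, R w v j ≤ (N + 2) ^ er := hbr w v N hw hs
  have hmb : m ≤ (N + 2) ^ en := hbn w v N hw hs
  have hav : ∀ (s' : ℕ → ℕ), (∀ i < b, s' i = s i) → (fun i => s' (a i)) = v := by
    intro s' h'
    funext i
    exact h' _ (ha i).1
  refine Exec.seq ((hcn w N s hw hs hb0 fun i hi => hsb i (by omega)).mono
    (pow_bound_mono (by omega))) ?_
  have e₂ : Exec w ((N + 2) ^ T) cg (0, Function.update s b m) (S 0) := by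
    have hav' := hav (Function.update s b m)
      (fun i hi => by rw [Function.update_of_ne (by omega)])
    have := hcg w N (Function.update s b m) hw (fun i => by rw [congrFun hav' i]; exact hs i)
      (by rw [Function.update_of_ne (by omega)]; exact hb2)
      (fun i hi => by rw [Function.update_of_ne (by omega)]; exact hsb i (by omega))
    rw [hav'] at this
    convert this.mono (pow_bound_mono (e' := T) (by omega)) using 1
    simp only [S, hR₀, Nat.sub_zero, Prod.mk.injEq, true_and]
    congr 1
    funext i
    simp only [Function.update_apply]
    split_ifs <;> grind
  refine Exec.seq e₂ (Exec.seq (Exec.loop_iterate m S ?_ ?_) ?_)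
  · intro j hj
    simp [S]
  · intro j hj
    set s₀ := Function.update (Function.update (Function.update s b (m - (j + 1))) (b + 1) j)
      (b + 2) (R w v j) with hs₀
    have e₀ : Function.update (S j).2 b (m - (j + 1)) = s₀ := by
      funext i
      simp only [S, hs₀, Function.update_apply]
      split_ifs <;> grind
    have hargs : (fun i => s₀ ((Fin.cons (b + 1) (Fin.cons (b + 2) a) : Fin (k + 2) → ℕ) i))
        = (Fin.cons j (Fin.cons (R w v j) v) : Fin (k + 2) → ℕ) := by
      funext i
      refine Fin.cases (by simp [hs₀]) (fun i => ?_) i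
      refine Fin.cases (by simp [hs₀]) (fun i => ?_) i
      have := (ha i).1
      simp only [Fin.cons_succ, hs₀, Function.update_apply]
      split_ifs <;> first | omega | rfl
    have hso₀ : s₀ o = 0 := by
      simp only [hs₀, Function.update_apply]
      split_ifs <;> omega
    rw [e₀]
    have e₁ := hch w ((N + 2) ^ (E + 1)) s₀ (hw.trans (hNle N)) (fun i => by
        rw [congrFun hargs i]
        refine Fin.cases ?_ (fun i => ?_) i
        · exact (hj.le.trans hmb).trans (pow_bound_mono (by omega))
        · refine Fin.cases ?_ (fun i => ?_) i
          · exact (hrb j hj.le).trans (pow_bound_mono (by omega))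
          · exact (hs i).trans (hNle N)) hso₀
      (fun i hi => by
        simp only [hs₀, Function.update_apply]
        split_ifs <;> first | omega | exact hsb i (by omega))
    rw [hargs, ← hR] at e₁
    refine Exec.seq (e₁.mono ((pow_bound_comp N E eh).trans (pow_bound_mono (by omega)))) ?_
    refine Exec.seq exec_clear ?_
    have hRj : R w v (j + 1) ≤ (N + 2) ^ T :=
      (hrb (j + 1) hj).trans (pow_bound_mono (by omega))
    refine Exec.seq (exec_transfer (by omega) ?_) ?_
    · rw [Function.update_self, Function.update_of_ne (by omega), Function.update_self]
      omega
    · have e₄ := Exec.inc (w := w) (B := (N + 2) ^ T) (p := 0) (r := b + 1)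
        (s := Function.update (Function.update s₀ (b + 2) (R w v (j + 1))) o 0) (by
          have : m ≤ (N + 2) ^ T := hmb.trans (pow_bound_mono (by omega))
          rw [Function.update_of_ne (by omega), Function.update_of_ne (by omega), hs₀,
            Function.update_of_ne (by omega), Function.update_self]
          omega)
      convert e₄ using 2
      · funext i
        simp only [Function.update_apply]
        split_ifs <;> grind
      · funext i
        simp only [Function.update_apply, hs₀]
        split_ifs <;> grind
  · refine Exec.seq exec_clear ?_
    have hRm : R w v m ≤ (N + 2) ^ T := (hrb m le_rfl).trans (pow_bound_mono (by omega))
    have := exec_transfer (w := w) (B := (N + 2) ^ T) (p := 0) (r := b + 2) (o := o)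
      (s := Function.update (S m).2 (b + 1) 0) (by omega) (by
        simp only [S, Function.update_apply]
        split_ifs <;> omega)
    convert this using 2
    funext i
    simp only [S, Function.update_apply]
    split_ifs <;> grind

/-- The head walks to the right end marker and counts its moves; the move off the left end marker
accounts for the extra one. -/
theorem length_add_one : LogFun (fun (w : List α) (_ : Fin k → ℕ) => w.length + 1) := by
  refine ⟨1, fun w v N hw _ => by simp; omega, fun b o a ha ho => ?_⟩
  refine ⟨seq (whileSymbol (fun x => match x with | .rightEnd => false | _ => true)
    (seq (Cmd.move .right) (Cmd.inc o))) rewind, fun w N s hw hs hso hsb => ?_⟩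
  refine Exec.seq (τ := (w.length + 1, Function.update s o (w.length + 1))) ?_ exec_rewind
  suffices ∀ m j, j + m = w.length + 1 → Exec w ((N + 2) ^ 1) (whileSymbol
      (fun x => match x with | .rightEnd => false | _ => true)
      (seq (Cmd.move .right) (Cmd.inc o))) (j, Function.update s o j)
      (w.length + 1, Function.update s o (w.length + 1)) by
    have h := this (w.length + 1) 0 (by omega)
    rwa [show Function.update s o 0 = s by rw [← hso]; simp] at h
  intro m
  induction m with
  | zero =>
    intro j hj
    obtain rfl : j = w.length + 1 := by omega
    exact .while_false (by simp [OfflineTM.inputAt])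
  | succ m ih =>
    intro j hj
    refine .while_true ?_ (.seq .move (.inc ?_)) ?_
    · rcases j with _ | j
      · rfl
      · simp [OfflineTM.inputAt, show j < w.length by omega]
    · simp; omega
    · have := ih (j + 1) (by omega)
      simpa [OfflineTM.moveInput, show j + 1 ≤ w.length + 1 by omega] using this

theorem inputAt_min (w : List α) (j : ℕ) :
    OfflineTM.inputAt w (min j (w.length + 1)) = OfflineTM.inputAt w j := by
  rcases le_total j (w.length + 1) with h | h
  · rw [min_eq_left h]
  · rw [min_eq_right h]
    obtain ⟨t, rfl⟩ : ∃ t, j = t + 1 := ⟨j - 1, by omega⟩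
    simp [OfflineTM.inputAt, show w.length ≤ t by omega]

/-- Random access to the input: a copy of the index drives the head to the right. An index beyond
the word is harmless because the head stops at the right end marker, as `inputAt_min` records. -/
theorem symbol_var (P : InputSymbol α → Bool) :
    LogFun (fun (w : List α) (v : Fin 1 → ℕ) => (P (OfflineTM.inputAt w (v 0 + 1))).toNat) := by
  refine ⟨1, fun w v N hw _ => by
    have := Bool.toNat_le (P (OfflineTM.inputAt w (v 0 + 1)))
    simp; omega, fun b o a ha ho => ?_⟩
  refine ⟨seq (copy (a 0) b (b + 1)) (seq (Cmd.move .right) (seq (loop b (Cmd.move .right))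
    (seq (cond P (Cmd.inc o)) rewind))), fun w N s hw hs hso hsb => ?_⟩
  have hb0 := hsb b le_rfl
  have h0 := ha 0
  refine Exec.seq (exec_copy (by omega) (by omega) (by omega) (hsb _ (by omega)) ?_) ?_
  · rw [hb0, pow_one]; have := hs 0; omega
  refine Exec.seq .move ?_
  set x := s (a 0) with hx
  rw [hb0, zero_add]
  have hloop := Exec.loop_iterate (w := w) (B := (N + 2) ^ 1) (r := b) (c := Cmd.move .right) x
    (fun j => (min (j + 1) (w.length + 1), Function.update s b (x - j))) (by simp)
    (fun j hj => by
      have := Exec.move (w := w) (B := (N + 2) ^ 1) (d := .right)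
        (p := min (j + 1) (w.length + 1)) (s := Function.update s b (x - (j + 1)))
      convert this using 2
      · simp
      · simp only [OfflineTM.moveInput]; omega)
  have hend : Function.update s b (x - x) = s := by rw [Nat.sub_self, ← hb0]; simp
  simp only [hend] at hloop
  have hpos : OfflineTM.inputAt w (min (x + 1) (w.length + 1)) = OfflineTM.inputAt w (x + 1) :=
    inputAt_min w (x + 1)
  refine Exec.seq (τ := (min (x + 1) (w.length + 1), s))
    (by simpa [OfflineTM.moveInput] using hloop) ?_
  change Exec w _ _ _ (0, Function.update s o (P (OfflineTM.inputAt w (x + 1))).toNat)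
  cases hP : P (OfflineTM.inputAt w (x + 1)) with
  | true =>
    refine Exec.seq (.cond_true (by rw [hpos]; exact hP) (.inc (by rw [hso, pow_one]; omega))) ?_
    rw [hso]
    exact exec_rewind
  | false =>
    refine Exec.seq (.cond_false (by rw [hpos]; exact hP)) ?_
    rw [show Function.update s o false.toNat = s by
      rw [Bool.toNat_false, ← hso]; simp]
    exact exec_rewind

end LogFun

theorem LogFun.mem_logSPACE {L : Language α} {f : List α → (Fin 0 → ℕ) → ℕ} (hf : LogFun f)
    (hL : ∀ w, f w Fin.elim0 % 2 = 1 ↔ w ∈ L) : L ∈ LogSPACE α := by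
  obtain ⟨e, -, hc⟩ := hf
  obtain ⟨c, hc⟩ := hc 1 0 Fin.elim0 (fun i => i.elim0) (by omega)
  -- There are no arguments: register `0` receives the result and all others are auxiliary.
  refine Cmd.mem_logSPACE c 0 e (fun w => f w Fin.elim0) hL fun w => ⟨0, _,
    hc w w.length 0 le_rfl (fun i => i.elim0) rfl (fun _ _ => rfl), ?_⟩
  rw [Function.update_self]
  congr 1
  funext i
  exact i.elim0

end LogFun

/-! ### Arithmetic, counting and bounded quantifiers -/

section LogFun

variable {α : Type} {k : ℕ}

namespace LogFun

theorem congr {f g : List α → (Fin k → ℕ) → ℕ} (hf : LogFun f) (h : ∀ w v, f w v = g w v) :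
    LogFun g := by
  have : f = g := funext fun w => funext fun v => h w v
  exact this ▸ hf

theorem comp₁ {g : List α → ℕ → ℕ} (hg : LogFun (fun w (v : Fin 1 → ℕ) => g w (v 0)))
    {x : List α → (Fin k → ℕ) → ℕ} (hx : LogFun x) : LogFun (fun w v => g w (x w v)) :=
  (hg.rename (fun _ => (0 : Fin (k + 1)))).cons_comp hx

theorem comp₂ {g : List α → ℕ → ℕ → ℕ}
    (hg : LogFun (fun w (v : Fin 2 → ℕ) => g w (v 0) (v 1)))
    {x y : List α → (Fin k → ℕ) → ℕ} (hx : LogFun x) (hy : LogFun y) :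
    LogFun (fun w v => g w (x w v) (y w v)) :=
  -- The value of `x` is substituted first, while slot `0` is still reserved for `y`; hence the
  -- shift of the variables of `x`.
  ((hg.rename ![(0 : Fin (k + 2)), 1]).cons_comp (hx.rename Fin.succ)).cons_comp hy

theorem const (c : ℕ) : LogFun (fun (_ : List α) (_ : Fin k → ℕ) => c) := by
  induction c with
  | zero => exact zero
  | succ c ih => exact ih.succ

theorem add {x y : List α → (Fin k → ℕ) → ℕ} (hx : LogFun x) (hy : LogFun y) :
    LogFun (fun w v => x w v + y w v) := by
  refine comp₂ (g := fun _ a b => a + b) ?_ hx hy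
  refine primrec (fun _ v j => v 0 + j) (var 1) (var 0) (var (1 : Fin 4)).succ
    (fun _ _ => rfl) (fun _ _ _ => rfl) ⟨2, fun w v N _ hv j hj => ?_⟩
  have h0 := hv 0
  have h1 := hv 1
  nlinarith

theorem mul {x y : List α → (Fin k → ℕ) → ℕ} (hx : LogFun x) (hy : LogFun y) :
    LogFun (fun w v => x w v * y w v) := by
  refine comp₂ (g := fun _ a b => a * b) ?_ hx hy
  refine primrec (fun _ v j => v 0 * j) (var 1) (const 0) ((var (1 : Fin 4)).add (var 2))
    (fun _ _ => rfl) (fun _ _ _ => rfl) ⟨2, fun w v N _ hv j hj => ?_⟩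
  have h0 := hv 0
  have h1 := hv 1
  have := Nat.mul_le_mul h0 (hj.trans h1)
  nlinarith

/-- Truncated subtraction iterates the predecessor, which is itself a recursion whose step returns
the index. -/
theorem sub {x y : List α → (Fin k → ℕ) → ℕ} (hx : LogFun x) (hy : LogFun y) :
    LogFun (fun w v => x w v - y w v) := by
  have hpred : LogFun (fun (_ : List α) (v : Fin 1 → ℕ) => v 0 - 1) := by
    refine primrec (fun _ v j => j - 1) (var 0) (const 0) (var (0 : Fin 3))
      (fun _ _ => rfl) (fun _ _ _ => rfl) ⟨1, fun w v N _ hv j hj => ?_⟩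
    have h0 := hv 0
    rw [pow_one]
    omega
  refine comp₂ (g := fun _ a b => a - b) ?_ hx hy
  refine primrec (fun _ v j => v 0 - j) (var 1) (var 0)
    (comp₁ (g := fun _ a => a - 1) hpred (var (1 : Fin 4)))
    (fun _ _ => rfl) (fun _ _ _ => rfl) ⟨1, fun w v N _ hv j hj => ?_⟩
  have h0 := hv 0
  rw [pow_one]
  omega

theorem length : LogFun (fun (w : List α) (_ : Fin k → ℕ) => w.length) :=
  (length_add_one.sub (const 1)).congr fun _ _ => rfl

/-- Polynomially many terms of polynomial size have a polynomial sum, so partial sums may be kept in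
a register. -/
theorem sum {n : List α → (Fin k → ℕ) → ℕ} {F : List α → ℕ → (Fin k → ℕ) → ℕ} (hn : LogFun n)
    (hF : LogFun (fun w (v : Fin (k + 1) → ℕ) => F w (v 0) (fun i => v i.succ))) :
    LogFun (fun w v => ∑ i ∈ Finset.range (n w v), F w i v) := by
  obtain ⟨en, hbn⟩ := hn.polyBounded
  obtain ⟨eF, hbF⟩ := hF.polyBounded
  refine primrec (fun w v j => ∑ i ∈ Finset.range j, F w i v) hn (const 0)
    ((var (1 : Fin (k + 2))).add
      -- Variable `0` is the summation index and variable `1` the partial sum, which `F` must skip.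
      (hF.rename (Fin.cons 0 fun i => i.succ.succ : Fin (k + 1) → Fin (k + 2))))
    (fun _ _ => rfl) (fun w v j => ?_) ⟨en + (en + 2) * eF, fun w v N hw hv j hj => ?_⟩
  · rw [Finset.sum_range_succ]
    rfl
  · have hN : N ≤ (N + 2) ^ (en + 1) :=
      le_trans (by omega) (le_pow_bound (N := N) (e := en + 1) (by omega))
    have hj' := hj.trans (hbn w v N hw hv)
    have h1 : ∀ i ∈ Finset.range j, F w i v ≤ (N + 2) ^ ((en + 2) * eF) := by
      intro i hi
      rw [Finset.mem_range] at hi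
      refine le_trans ?_ (pow_bound_comp N en eF)
      have := hbF w (Fin.cons i v) ((N + 2) ^ (en + 1)) (hw.trans hN) (fun t => by
        refine Fin.cases ?_ (fun t => ?_) t
        · exact (hi.le.trans hj').trans (pow_bound_mono (by omega))
        · exact (hv t).trans hN)
      exact this
    have h2 := Finset.sum_le_card_nsmul _ _ _ h1
    rw [Finset.card_range, smul_eq_mul] at h2
    rw [pow_add]
    exact h2.trans (Nat.mul_le_mul_right _ hj')

end LogFun

open Classical in
/-- The predicate `P` has a characteristic function in `LogFun`. -/
def LogPred (P : List α → (Fin k → ℕ) → Prop) : Prop :=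
  LogFun (fun w v => if P w v then 1 else 0)

namespace LogPred

open LogFun

theorem congr {P Q : List α → (Fin k → ℕ) → Prop} (hP : LogPred P) (h : ∀ w v, P w v ↔ Q w v) :
    LogPred Q := by
  have : P = Q := funext fun w => funext fun v => propext (h w v)
  exact this ▸ hP

theorem not {P : List α → (Fin k → ℕ) → Prop} (hP : LogPred P) : LogPred (fun w v => ¬ P w v) :=
  ((const 1).sub hP).congr fun w v => by by_cases h : P w v <;> simp [h]

theorem and {P Q : List α → (Fin k → ℕ) → Prop} (hP : LogPred P) (hQ : LogPred Q) :
    LogPred (fun w v => P w v ∧ Q w v) :=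
  (LogFun.mul hP hQ).congr fun w v => by
    by_cases h : P w v <;> by_cases h' : Q w v <;> simp [h, h']

theorem imp {P Q : List α → (Fin k → ℕ) → Prop} (hP : LogPred P) (hQ : LogPred Q) :
    LogPred (fun w v => P w v → Q w v) :=
  (hP.and hQ.not).not.congr fun w v => by tauto

theorem iff {P Q : List α → (Fin k → ℕ) → Prop} (hP : LogPred P) (hQ : LogPred Q) :
    LogPred (fun w v => P w v ↔ Q w v) :=
  ((hP.imp hQ).and (hQ.imp hP)).congr fun w v => by tauto

theorem le {x y : List α → (Fin k → ℕ) → ℕ} (hx : LogFun x) (hy : LogFun y) :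
    LogPred (fun w v => x w v ≤ y w v) :=
  ((const 1).sub (hx.sub hy)).congr fun w v => by split_ifs <;> omega

theorem lt {x y : List α → (Fin k → ℕ) → ℕ} (hx : LogFun x) (hy : LogFun y) :
    LogPred (fun w v => x w v < y w v) :=
  (LogPred.le hx.succ hy).congr fun _ _ => Iff.rfl

theorem eq {x y : List α → (Fin k → ℕ) → ℕ} (hx : LogFun x) (hy : LogFun y) :
    LogPred (fun w v => x w v = y w v) :=
  ((LogPred.le hx hy).and (LogPred.le hy hx)).congr fun _ _ => le_antisymm_iff.symm

/-- A bounded universal statement holds exactly if it has zero counterexamples, and counting them is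
a sum. -/
theorem forall_lt {n : List α → (Fin k → ℕ) → ℕ} {P : List α → ℕ → (Fin k → ℕ) → Prop}
    (hn : LogFun n) (hP : LogPred (fun w (v : Fin (k + 1) → ℕ) => P w (v 0) (fun i => v i.succ))) :
    LogPred (fun w v => ∀ i < n w v, P w i v) := by
  classical
  have h := LogFun.sum (F := fun w i v => if ¬ P w i v then 1 else 0) hn
    (LogFun.congr hP.not fun w v => by
      by_cases h : P w (v 0) (fun i => v i.succ) <;> simp [h])
  refine (LogPred.eq h (const 0)).congr fun w v => ?_
  simp [Finset.sum_eq_zero_iff]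

theorem exists_lt {n : List α → (Fin k → ℕ) → ℕ} {P : List α → ℕ → (Fin k → ℕ) → Prop}
    (hn : LogFun n) (hP : LogPred (fun w (v : Fin (k + 1) → ℕ) => P w (v 0) (fun i => v i.succ))) :
    LogPred (fun w v => ∃ i < n w v, P w i v) :=
  (forall_lt (P := fun w i v => ¬ P w i v) hn hP.not).not.congr fun w v => by
    push Not
    rfl

theorem symbol (P : InputSymbol α → Bool) {x : List α → (Fin k → ℕ) → ℕ} (hx : LogFun x) :
    LogPred (fun w v => P (OfflineTM.inputAt w (x w v + 1)) = true) :=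
  (comp₁ (g := fun w a => (P (OfflineTM.inputAt w (a + 1))).toNat) (symbol_var P) hx).congr
    fun w v => by
      cases h : P (OfflineTM.inputAt w (x w v + 1)) <;> simp [h]

open Classical in
theorem ite {P : List α → (Fin k → ℕ) → Prop} {f g : List α → (Fin k → ℕ) → ℕ} (hP : LogPred P)
    (hf : LogFun f) (hg : LogFun g) : LogFun (fun w v => if P w v then f w v else g w v) :=
  ((LogFun.mul hP hf).add (LogFun.mul hP.not hg)).congr fun w v => by
    by_cases h : P w v <;> simp [h]

open Classical in
theorem card {n : List α → (Fin k → ℕ) → ℕ} {P : List α → ℕ → (Fin k → ℕ) → Prop} (hn : LogFun n)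
    (hP : LogPred (fun w (v : Fin (k + 1) → ℕ) => P w (v 0) (fun i => v i.succ))) :
    LogFun (fun w v => ((Finset.range (n w v)).filter (P w · v)).card) :=
  (LogFun.sum (F := fun w i v => if P w i v then 1 else 0) hn hP).congr fun w v => by
    simp

theorem mem_logSPACE {L : Language α} {P : List α → (Fin 0 → ℕ) → Prop} (hP : LogPred P)
    (hL : ∀ w, P w Fin.elim0 ↔ w ∈ L) : L ∈ LogSPACE α :=
  LogFun.mem_logSPACE hP fun w => by
    rw [← hL]
    by_cases h : P w Fin.elim0 <;> simp [h]

end LogPred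

end LogFun

/-! ### Independent offensive alliances under token sliding -/

namespace AllianceReconf

variable {V : Type*} {G : SimpleGraph V} {A B C : Set V}

theorem IsIsolatedEdge.symm {x y : V} (h : IsIsolatedEdge G x y) : IsIsolatedEdge G y x :=
  ⟨h.1.symm, h.2.2, h.2.1⟩

theorem IsIsolatedEdge.eq_of_adj {x y z : V} (h : IsIsolatedEdge G x y) (hz : G.Adj x z) :
    z = y := by
  obtain ⟨u, hu⟩ := Set.ncard_eq_one.1 h.2.1
  have hz' : z ∈ G.neighborSet x := hz
  have hy' : y ∈ G.neighborSet x := h.1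
  rw [hu] at hz' hy'
  exact hz'.trans hy'.symm

theorem not_adj_of_mem (hA : IsIndepOffensiveAlliance G A) {u v : V} (hu : u ∈ A) (hv : v ∈ A) :
    ¬ G.Adj u v :=
  fun h => hA.2 hu hv h.ne h

/-- Any neighbour of `y` in `A` is outside `B` by independence, hence equals `x`. So `y` has at most
one neighbour in `A`, and the alliance inequality at `y` excludes neighbours outside `A`. -/
theorem neighborSet_eq_singleton [Finite V] (hA : IsIndepOffensiveAlliance G A)
    (hB : IsIndepOffensiveAlliance G B) {x y : V} (hx : x ∈ A) (hy : y ∈ B \ A) (h : G.Adj x y)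
    (hAB : A \ B ⊆ {x}) : G.neighborSet y = {x} := by
  have h1 : G.neighborSet y ∩ A ⊆ {x} := by
    rintro u ⟨hu, huA⟩
    refine hAB ⟨huA, fun huB => not_adj_of_mem hB hy.1 huB hu⟩
  have h2 : degIn G A y ≤ 1 := (Set.ncard_le_ncard h1).trans (Set.ncard_singleton x).le
  have h3 := hA.1 y ⟨⟨x, hx, h⟩, hy.2⟩
  have h4 : G.neighborSet y ∩ Aᶜ = ∅ := by
    rw [← Set.ncard_eq_zero]
    change degIn G Aᶜ y = 0
    omega
  refine Set.Subset.antisymm (fun u hu => ?_) (by simpa using h.symm)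
  by_cases huA : u ∈ A
  · exact h1 ⟨hu, huA⟩
  · exact (h4 ▸ (⟨hu, huA⟩ : u ∈ G.neighborSet y ∩ Aᶜ) : u ∈ (∅ : Set V)).elim

theorem IsTokenSlide.ncard_diff [Finite V] (h : IsTokenSlide G A B) : (B \ A).ncard = 1 := by
  have h1 := Set.ncard_inter_add_ncard_sdiff_eq_ncard A B
  have h2 := Set.ncard_inter_add_ncard_sdiff_eq_ncard B A
  rw [Set.inter_comm] at h2
  have h3 := h.1.1
  have h4 := h.1.2
  omega

/-- A slide is reversible, so the leaf argument applies at both ends of the edge. -/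
theorem IsTokenSlide.isIsolatedEdge [Finite V] (hA : IsIndepOffensiveAlliance G A)
    (hB : IsIndepOffensiveAlliance G B) (h : IsTokenSlide G A B) {x y : V} (hx : x ∈ A \ B)
    (hy : y ∈ B \ A) : IsIsolatedEdge G x y := by
  have hadj := h.2 x hx y hy
  obtain ⟨x', hx'⟩ := Set.ncard_eq_one.1 h.1.2
  obtain ⟨y', hy'⟩ := Set.ncard_eq_one.1 h.ncard_diff
  have ex : x = x' := by simpa [hx'] using hx
  have ey : y = y' := by simpa [hy'] using hy
  subst ex ey
  exact ⟨hadj, by rw [IsLeaf, neighborSet_eq_singleton hB hA hy.1 hx hadj.symm hy'.le,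
    Set.ncard_singleton], by rw [IsLeaf, neighborSet_eq_singleton hA hB hx.1 hy hadj hx'.le,
    Set.ncard_singleton]⟩

/-- Every vertex of `A \ B` is joined to a vertex of `B` by an isolated edge. -/
def Matched (G : SimpleGraph V) (A B : Set V) : Prop :=
  ∀ v ∈ A \ B, ∃ u ∈ B, IsIsolatedEdge G v u

/-- Induction on the sequence: its first step only exchanges the two ends of an isolated edge, which
affects no other pair, and it shrinks `A \ B` by at most one vertex. -/
theorem matched_of_isReconfSeq [Finite V] (l : List (Set V))
    (h : IsReconfSeq (IsIndepOffensiveAlliance G) (IsTokenSlide G) A B l) :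
    Matched G A B ∧ Matched G B A ∧ (A \ B).ncard + 1 ≤ l.length := by
  induction l generalizing A with
  | nil => simp [IsReconfSeq] at h
  | cons A' l ih =>
    obtain ⟨h1, h2, h3, h4⟩ := h
    obtain rfl : A' = A := by simpa using h1
    rcases l with _ | ⟨C, l⟩
    · obtain rfl : A' = B := by simpa using h2
      simp [Matched]
    · rw [List.isChain_cons_cons] at h3
      obtain ⟨m1, m2, m3⟩ := ih (A := C) ⟨rfl, by simpa using h2, h3.2,
        fun D hD => h4 D (List.mem_cons_of_mem _ hD)⟩
      have hs := h3.1
      obtain ⟨x, hx⟩ := Set.ncard_eq_one.1 hs.1.2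
      obtain ⟨y, hy⟩ := Set.ncard_eq_one.1 hs.ncard_diff
      have hx' : x ∈ A' \ C := by simp [hx]
      have hy' : y ∈ C \ A' := by simp [hy]
      have hiso := hs.isIsolatedEdge (h4 _ (by simp)) (h4 _ (by simp)) hx' hy'
      have hA : ∀ v ∈ A', v = x ∨ v ∈ C := fun v hv => by
        by_cases hvC : v ∈ C
        · exact Or.inr hvC
        · exact Or.inl (hx.subset ⟨hv, hvC⟩)
      have hC : ∀ v ∈ C, v = y ∨ v ∈ A' := fun v hv => by
        by_cases hvC : v ∈ A'
        · exact Or.inr hvC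
        · exact Or.inl (hy.subset ⟨hv, hvC⟩)
      refine ⟨?_, ?_, ?_⟩
      · rintro v ⟨hv, hvB⟩
        rcases hA v hv with rfl | hvC
        · refine ⟨y, ?_, hiso⟩
          -- Otherwise the partner of `y` would belong to `B`; but the only neighbour of `y` is the
          -- vertex just left, which is outside `B`.
          by_contra hyB
          obtain ⟨u, hu, huy⟩ := m1 y ⟨hy'.1, hyB⟩
          exact hvB (huy.eq_of_adj hiso.symm.1 ▸ hu)
        · exact m1 v ⟨hvC, hvB⟩
      · rintro u ⟨hu, huA⟩
        by_cases huC : u ∈ C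
        · rcases hC u huC with rfl | h
          · exact ⟨x, hx'.1, hiso.symm⟩
          · exact (huA h).elim
        · obtain ⟨v, hv, hvu⟩ := m2 u ⟨hu, huC⟩
          rcases hC v hv with rfl | h
          · exact (huA (hiso.symm.eq_of_adj hvu.symm.1 ▸ hx'.1)).elim
          · exact ⟨v, h, hvu⟩
      · have : A' \ B ⊆ (A' \ C) ∪ (C \ B) := fun v hv => by
          by_cases hvC : v ∈ C
          · exact Or.inr ⟨hvC, hv.2⟩
          · exact Or.inl ⟨hv.1, hvC⟩
        have h5 := (Set.ncard_le_ncard this).trans (Set.ncard_union_le _ _)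
        have h6 := hs.1.2
        simp only [List.length_cons] at m3 ⊢
        omega

/-- The vertex `x` now has its single neighbour inside the set, which meets its inequality with
equality. Every other boundary vertex is adjacent to neither `x` nor `y` and keeps its counts. -/
theorem slide_isIndepOffensiveAlliance (hA : IsIndepOffensiveAlliance G A) {x y : V}
    (hx : x ∈ A) (h : IsIsolatedEdge G x y) :
    IsIndepOffensiveAlliance G (insert y (A \ {x})) := by
  have hyA : y ∉ A := fun hy => not_adj_of_mem hA hx hy h.1
  refine ⟨?_, ?_⟩
  · rintro v ⟨⟨u, hu, huv⟩, hv⟩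
    rw [Set.mem_insert_iff, not_or] at hv
    by_cases hvx : v = x
    · subst hvx
      have hN : G.neighborSet v = {y} :=
        Set.Subset.antisymm (fun z hz => h.eq_of_adj hz) (by simpa using h.1)
      have e1 : ({y} : Set V) ∩ insert y (A \ {v}) = {y} := by simp
      have e2 : ({y} : Set V) ∩ (insert y (A \ {v}))ᶜ = ∅ := by simp
      simp [degIn, hN, e1, e2]
    · have hvA : v ∉ A := fun h' => hv.2 ⟨h', hvx⟩
      have hux : u ≠ y := fun e => hvx (h.symm.eq_of_adj (e ▸ huv))
      have huA : u ∈ A := by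
        rcases hu with rfl | hu
        · exact (hux rfl).elim
        · exact hu.1
      have hmem : ∀ z ∈ G.neighborSet v, (z ∈ insert y (A \ {x}) ↔ z ∈ A) := by
        intro z hz
        have hzx : z ≠ x := fun e => hv.1 (h.eq_of_adj (e ▸ (hz : G.Adj v z).symm))
        have hzy : z ≠ y := fun e => hvx (h.symm.eq_of_adj (e ▸ (hz : G.Adj v z).symm))
        simp [hzx, hzy]
      have e1 : G.neighborSet v ∩ insert y (A \ {x}) = G.neighborSet v ∩ A := by
        ext z
        exact and_congr_right fun hz => hmem z hz
      have e2 : G.neighborSet v ∩ (insert y (A \ {x}))ᶜ = G.neighborSet v ∩ Aᶜ := by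
        ext z
        exact and_congr_right fun hz => not_congr (hmem z hz)
      have := hA.1 v ⟨⟨u, huA, huv⟩, hvA⟩
      simpa only [degIn, e1, e2] using this
  · have hy : ∀ z ∈ A \ {x}, ¬ G.Adj y z := fun z hz hadj => hz.2 (h.symm.eq_of_adj hadj)
    rintro u (rfl | hu) v (rfl | hv) huv hadj
    · exact huv rfl
    · exact hy v hv hadj
    · exact hy u hu hadj.symm
    · exact not_adj_of_mem hA hu.1 hv.1 hadj

/-- Sliding any vertex of `A \ B` to its partner in `B` removes it from the difference and leaves
the remaining pairs intact, so `d` slides suffice. -/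
theorem exists_isReconfSeq_of_matched [Finite V] (d : ℕ) (hA : IsIndepOffensiveAlliance G A)
    (hB : IsIndepOffensiveAlliance G B) (hAB : Matched G A B) (hBA : Matched G B A)
    (hd : (A \ B).ncard = d) :
    ∃ l, IsReconfSeq (IsIndepOffensiveAlliance G) (IsTokenSlide G) A B l ∧ l.length = d + 1 := by
  induction d generalizing A with
  | zero =>
    rw [Set.ncard_eq_zero, Set.sdiff_eq_empty] at hd
    -- With `A ⊆ B`, a vertex of `B` outside `A` would be adjacent to its partner, which also lies
    -- in `B`.
    have hBA' : B ⊆ A := by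
      intro u hu
      by_contra huA
      obtain ⟨v, hv, hvu⟩ := hBA u ⟨hu, huA⟩
      exact not_adj_of_mem hB hu (hd hv) hvu.1
    obtain rfl := Set.Subset.antisymm hd hBA'
    exact ⟨[A], ⟨rfl, rfl, List.isChain_singleton _, by simpa using hA⟩, rfl⟩
  | succ d ih =>
    obtain ⟨x, hx⟩ : (A \ B).Nonempty := Set.nonempty_of_ncard_ne_zero (by omega)
    obtain ⟨y, hy, hxy⟩ := hAB x hx
    have hyA : y ∉ A := fun h => not_adj_of_mem hA hx.1 h hxy.1
    set C := insert y (A \ {x}) with hC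
    have hCd : C \ B = (A \ B) \ {x} := by
      ext z
      simp only [hC, Set.mem_sdiff, Set.mem_insert_iff, Set.mem_singleton_iff]
      refine ⟨?_, fun h => ⟨Or.inr ⟨h.1.1, h.2⟩, h.1.2⟩⟩
      rintro ⟨rfl | h, hz⟩
      · exact (hz hy).elim
      · exact ⟨⟨h.1, hz⟩, h.2⟩
    have hxy' : x ≠ y := hxy.1.ne
    have hAC : A \ C = {x} := by
      ext z
      simp only [hC, Set.mem_sdiff, Set.mem_insert_iff, Set.mem_singleton_iff]
      constructor
      · rintro ⟨h1, h2⟩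
        by_contra h3
        exact h2 (Or.inr ⟨h1, h3⟩)
      · rintro rfl
        exact ⟨hx.1, by simp [hxy']⟩
    have hCA : C \ A = {y} := by
      ext z
      simp only [hC, Set.mem_sdiff, Set.mem_insert_iff, Set.mem_singleton_iff]
      constructor
      · rintro ⟨h1 | h1, h2⟩
        · exact h1
        · exact (h2 h1.1).elim
      · rintro rfl
        exact ⟨Or.inl rfl, hyA⟩
    have hslide : IsTokenSlide G A C := by
      refine ⟨⟨?_, by rw [hAC, Set.ncard_singleton]⟩, ?_⟩
      · rw [← Set.ncard_inter_add_ncard_sdiff_eq_ncard A C,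
          ← Set.ncard_inter_add_ncard_sdiff_eq_ncard C A, hAC, hCA, Set.inter_comm]
        simp
      · rw [hAC, hCA]
        rintro _ rfl _ rfl
        exact hxy.1
    have hCI := slide_isIndepOffensiveAlliance hA hx.1 hxy
    obtain ⟨l, ⟨l1, l2, l3, l4⟩, hl⟩ := ih (A := C) hCI
      (fun v hv => by
        rw [hCd] at hv
        exact hAB v hv.1)
      (fun u hu => by
        have huA : u ∉ A := by
          intro huA
          have : u = x := by
            have : u ∈ A \ C := ⟨huA, hu.2⟩
            rwa [hAC] at this
          exact hx.2 (this ▸ hu.1)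
        obtain ⟨v, hv, huv⟩ := hBA u ⟨hu.1, huA⟩
        -- The partner is not `x`: the only neighbour of `x` is `y`, which already lies in `C`,
        -- while `u` does not.
        refine ⟨v, Or.inr ⟨hv, ?_⟩, huv⟩
        rintro rfl
        exact hu.2 (hxy.eq_of_adj huv.symm.1 ▸ Or.inl rfl))
      (by rw [hCd, Set.ncard_sdiff_singleton_of_mem hx, hd]; rfl)
    refine ⟨A :: l, ⟨rfl, ?_, ?_, ?_⟩, by simp [hl]⟩
    · rw [List.getLast?_cons, l2]; rfl
    · rcases l with _ | ⟨D, l⟩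
      · simp at l1
      · obtain rfl : D = C := by simpa using l1
        exact List.isChain_cons_cons.2 ⟨hslide, l3⟩
    · intro D hD
      rcases List.mem_cons.1 hD with rfl | hD
      · exact hA
      · exact l4 D hD

theorem exists_isReconfSeq_iff [Finite V] (hA : IsIndepOffensiveAlliance G A)
    (hB : IsIndepOffensiveAlliance G B) :
    (∃ l, IsReconfSeq (IsIndepOffensiveAlliance G) (IsTokenSlide G) A B l) ↔
      Matched G A B ∧ Matched G B A := by
  constructor
  · rintro ⟨l, hl⟩
    exact ⟨(matched_of_isReconfSeq l hl).1, (matched_of_isReconfSeq l hl).2.1⟩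
  · rintro ⟨h1, h2⟩
    obtain ⟨l, hl, -⟩ := exists_isReconfSeq_of_matched _ hA hB h1 h2 rfl
    exact ⟨l, hl⟩

theorem exists_isReconfSeq_length_lt_iff [Finite V] (hA : IsIndepOffensiveAlliance G A)
    (hB : IsIndepOffensiveAlliance G B) (T : ℕ) :
    (∃ l, l.length < T ∧ IsReconfSeq (IsIndepOffensiveAlliance G) (IsTokenSlide G) A B l) ↔
      Matched G A B ∧ Matched G B A ∧ (A \ B).ncard + 1 < T := by
  constructor
  · rintro ⟨l, hT, hl⟩
    obtain ⟨h1, h2, h3⟩ := matched_of_isReconfSeq l hl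
    exact ⟨h1, h2, h3.trans_lt hT⟩
  · rintro ⟨h1, h2, h3⟩
    obtain ⟨l, hl, hlen⟩ := exists_isReconfSeq_of_matched _ hA hB h1 h2 rfl
    exact ⟨l, by omega, hl⟩

end AllianceReconf

/-! ### Decoding instances -/

theorem getElem?_flatten_of_length {β : Type*} {m : ℕ} (ls : List (List β))
    (h : ∀ l ∈ ls, l.length = m) (i j : ℕ) (hj : j < m) :
    ls.flatten[i * m + j]? = ls[i]?.bind (·[j]?) := by
  induction ls generalizing i with
  | nil => simp
  | cons l ls ih =>
    have hl : l.length = m := h l (by simp)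
    rcases i with _ | i
    · simp [List.getElem?_append, hl, hj]
    · have := ih (fun l hl => h l (by simp [hl])) i
      rw [List.flatten_cons, List.getElem?_append_right (by rw [hl]; nlinarith), hl,
        show (i + 1) * m + j - m = i * m + j by
          rw [add_mul, one_mul]; omega, this]
      simp

theorem ncard_setOf_fin {n : ℕ} (P : ℕ → Prop) [DecidablePred P] :
    {i : Fin n | P i}.ncard = ((Finset.range n).filter P).card := by
  rw [← Set.ncard_coe_finset, ← Set.ncard_image_of_injective _ Fin.val_injective]
  congr 1
  ext j
  simp only [Set.mem_image, Set.mem_ofPred_eq, Finset.coe_filter, Finset.mem_range]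
  constructor
  · rintro ⟨i, hi, rfl⟩
    exact ⟨i.2, hi⟩
  · rintro ⟨h1, h2⟩
    exact ⟨⟨j, h1⟩, h2, rfl⟩

namespace AllianceReconf

/-- The bit in row `i` and column `j` of the table of bits encoded by `w`. -/
def BitAt (w : List Letter) (n i j : ℕ) : Prop := w[i * (n + 1) + j]? = some (some true)

/-- Symmetric off-diagonal entries of the table. -/
def AdjAt (w : List Letter) (n i j : ℕ) : Prop := i ≠ j ∧ BitAt w n i j ∧ BitAt w n j i

/-- The graph encoded by the first `n` rows. -/
def decodeGraph (w : List Letter) (n : ℕ) : SimpleGraph (Fin n) where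
  Adj i j := AdjAt w n i j
  symm := ⟨fun _ _ h => ⟨h.1.symm, h.2.2, h.2.1⟩⟩
  loopless := ⟨fun _ h => h.1 rfl⟩

/-- The set encoded by the row `r`. -/
def decodeSet (w : List Letter) (n r : ℕ) : Set (Fin n) := {i | BitAt w n r i}

/-- The word `w` begins with the encoding of a graph with `n` vertices and two sets. -/
def Format (w : List Letter) (n : ℕ) : Prop :=
  (n + 2) * (n + 1) ≤ w.length ∧
  (∀ i < n + 2, ∀ j < n + 1, (w[i * (n + 1) + j]? = some none ↔ j = n)) ∧
  (∀ i < n, ∀ j < n, BitAt w n i j → AdjAt w n i j)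

/-! ### Positions of the bits in an encoded instance -/

section Encode

variable {n : ℕ} (G : SimpleGraph (Fin n)) (As At : Set (Fin n))

theorem length_encodeSet (A : Set (Fin n)) : (encodeSet A).length = n + 1 := by
  simp [encodeSet]

open Classical in
theorem getElem?_encodeSet (A : Set (Fin n)) (j : Fin n) :
    (encodeSet A)[(j : ℕ)]? = some (some (decide (j ∈ A))) := by
  rw [encodeSet, List.getElem?_append_left (by simp)]
  simp

theorem getElem?_encodeSet_last (A : Set (Fin n)) : (encodeSet A)[n]? = some none := by
  rw [encodeSet, List.getElem?_append_right (by simp)]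
  simp

/-- The rows of the encoding. -/
noncomputable def encodeRows : List (List Letter) :=
  (List.ofFn fun i => encodeSet (G.neighborSet i)) ++ [encodeSet As, encodeSet At]

theorem encodeInstance_eq : encodeInstance G As At = (encodeRows G As At).flatten := by
  simp [encodeInstance, encodeGraph, encodeRows]

theorem length_of_mem_encodeRows (l : List Letter) (hl : l ∈ encodeRows G As At) :
    l.length = n + 1 := by
  simp only [encodeRows, List.mem_append, List.mem_ofFn, List.mem_cons, List.not_mem_nil,
    or_false] at hl
  rcases hl with ⟨i, rfl⟩ | rfl | rfl <;> exact length_encodeSet _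

theorem length_encodeRows : (encodeRows G As At).length = n + 2 := by simp [encodeRows]

theorem length_encodeInstance : (encodeInstance G As At).length = (n + 2) * (n + 1) := by
  rw [encodeInstance_eq, List.length_flatten, List.eq_replicate_of_mem (a := n + 1)
    (l := (encodeRows G As At).map List.length)]
  · simp [length_encodeRows]
  · intro b hb
    obtain ⟨l, hl, rfl⟩ := List.mem_map.1 hb
    exact length_of_mem_encodeRows G As At l hl

theorem index_lt {i j : ℕ} (hi : i < n + 2) (hj : j < n + 1) :
    i * (n + 1) + j < (n + 2) * (n + 1) := by
  have : (i + 1) * (n + 1) ≤ (n + 2) * (n + 1) := Nat.mul_le_mul_right _ hi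
  rw [add_mul, one_mul] at this
  omega

/-- All rows have length `n + 1`, so an entry is found by its row and column. The tail `t` allows
for the digits of the time bound, so that both problems share the decoding. -/
theorem getElem?_encodeInstance_append (t : List Letter) {i j : ℕ} (hi : i < n + 2)
    (hj : j < n + 1) :
    (encodeInstance G As At ++ t)[i * (n + 1) + j]? = (encodeRows G As At)[i]?.bind (·[j]?) := by
  rw [List.getElem?_append_left (by rw [length_encodeInstance]; exact index_lt hi hj),
    encodeInstance_eq, getElem?_flatten_of_length _ (length_of_mem_encodeRows G As At) _ _ hj]

theorem getElem?_encodeRows_graph (i : Fin n) :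
    (encodeRows G As At)[(i : ℕ)]? = some (encodeSet (G.neighborSet i)) := by
  rw [encodeRows, List.getElem?_append_left (by simp)]
  simp

theorem getElem?_encodeRows_start : (encodeRows G As At)[n]? = some (encodeSet As) := by
  rw [encodeRows, List.getElem?_append_right (by simp)]
  simp

theorem getElem?_encodeRows_target : (encodeRows G As At)[n + 1]? = some (encodeSet At) := by
  rw [encodeRows, List.getElem?_append_right (by simp)]
  simp

theorem exists_getElem?_encodeRows {i : ℕ} (hi : i < n + 2) :
    ∃ A : Set (Fin n), (encodeRows G As At)[i]? = some (encodeSet A) := by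
  rcases lt_or_ge i n with h | h
  · exact ⟨_, getElem?_encodeRows_graph G As At ⟨i, h⟩⟩
  · obtain rfl | rfl : i = n ∨ i = n + 1 := by omega
    · exact ⟨_, getElem?_encodeRows_start G As At⟩
    · exact ⟨_, getElem?_encodeRows_target G As At⟩

theorem bitAt_encodeInstance_append (t : List Letter) {i : ℕ} (hi : i < n + 2) {A : Set (Fin n)}
    (hA : (encodeRows G As At)[i]? = some (encodeSet A)) (j : Fin n) :
    BitAt (encodeInstance G As At ++ t) n i j ↔ j ∈ A := by
  rw [BitAt, getElem?_encodeInstance_append G As At t hi (by omega), hA, Option.bind_some,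
    getElem?_encodeSet]
  simp

theorem bitAt_graph_encodeInstance_append (t : List Letter) (i j : Fin n) :
    BitAt (encodeInstance G As At ++ t) n i j ↔ G.Adj i j := by
  rw [bitAt_encodeInstance_append G As At t (by omega) (getElem?_encodeRows_graph G As At i)]
  rfl

theorem adjAt_encodeInstance_append (t : List Letter) (i j : Fin n) :
    AdjAt (encodeInstance G As At ++ t) n i j ↔ G.Adj i j := by
  rw [AdjAt, bitAt_graph_encodeInstance_append, bitAt_graph_encodeInstance_append]
  exact ⟨fun h => h.2.1, fun h => ⟨fun e => h.ne (Fin.ext e), h, h.symm⟩⟩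

theorem decodeGraph_encodeInstance_append (t : List Letter) :
    decodeGraph (encodeInstance G As At ++ t) n = G := by
  ext i j
  exact adjAt_encodeInstance_append G As At t i j

theorem decodeSet_start (t : List Letter) :
    decodeSet (encodeInstance G As At ++ t) n n = As := by
  ext i
  exact bitAt_encodeInstance_append G As At t (by omega) (getElem?_encodeRows_start G As At) i

theorem decodeSet_target (t : List Letter) :
    decodeSet (encodeInstance G As At ++ t) n (n + 1) = At := by
  ext i
  exact bitAt_encodeInstance_append G As At t (by omega) (getElem?_encodeRows_target G As At) i

theorem format_encodeInstance_append (t : List Letter) :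
    Format (encodeInstance G As At ++ t) n := by
  refine ⟨by simp [length_encodeInstance], fun i hi j hj => ?_, fun i hi j hj h => ?_⟩
  · obtain ⟨A, hA⟩ := exists_getElem?_encodeRows G As At hi
    rw [getElem?_encodeInstance_append G As At t hi hj, hA, Option.bind_some]
    rcases Nat.lt_succ_iff_lt_or_eq.1 hj with h | rfl
    · have := getElem?_encodeSet A ⟨j, h⟩
      dsimp only at this
      rw [this]
      simp [h.ne]
    · simp [getElem?_encodeSet_last]
  · have h' := (bitAt_graph_encodeInstance_append G As At t ⟨i, hi⟩ ⟨j, hj⟩).1 h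
    exact (adjAt_encodeInstance_append G As At t ⟨i, hi⟩ ⟨j, hj⟩).2 h'

end Encode

-- The format conditions leave no freedom: separators fill exactly the last column, every other
-- entry is a bit, and the graph rows are symmetric and loopless. Re-encoding the decoded data thus
-- restores the prefix letter by letter.
open Classical in
theorem eq_encodeInstance_append {w : List Letter} {n : ℕ} (h : Format w n) :
    w = encodeInstance (decodeGraph w n) (decodeSet w n n) (decodeSet w n (n + 1))
      ++ w.drop ((n + 2) * (n + 1)) := by
  obtain ⟨hlen, hsep, hadj⟩ := h
  set W := encodeInstance (decodeGraph w n) (decodeSet w n n) (decodeSet w n (n + 1)) with hW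
  have hWl : W.length = (n + 2) * (n + 1) := length_encodeInstance _ _ _
  suffices w.take ((n + 2) * (n + 1)) = W by
    rw [← this, List.take_append_drop]
  refine List.ext_getElem? fun p => ?_
  rcases lt_or_ge p ((n + 2) * (n + 1)) with hp | hp
  swap
  · rw [List.getElem?_eq_none (by simp; omega), List.getElem?_eq_none (by omega)]
  rw [List.getElem?_take_of_lt hp]
  obtain ⟨i, j, hi, hj, rfl⟩ : ∃ i j, i < n + 2 ∧ j < n + 1 ∧ p = i * (n + 1) + j :=
    ⟨p / (n + 1), p % (n + 1), Nat.div_lt_of_lt_mul (by rwa [mul_comm] at hp),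
      Nat.mod_lt _ (by omega), (Nat.div_add_mod' p (n + 1)).symm⟩
  have key := getElem?_encodeInstance_append (decodeGraph w n) (decodeSet w n n)
    (decodeSet w n (n + 1)) [] hi hj
  rw [List.append_nil, ← hW] at key
  rw [key]
  rcases Nat.lt_succ_iff_lt_or_eq.1 hj with hjn | rfl
  · have hbit : w[i * (n + 1) + j]? = some (some (decide (BitAt w n i j))) := by
      have h1 : w[i * (n + 1) + j]? ≠ some none := fun h => hjn.ne ((hsep i hi j hj).1 h)
      obtain ⟨a, ha⟩ : ∃ a, w[i * (n + 1) + j]? = some a :=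
        ⟨_, List.getElem?_eq_getElem (by omega)⟩
      have hb : BitAt w n i j ↔ a = some true := by rw [BitAt, ha, Option.some_inj]
      rw [ha] at h1 ⊢
      rcases a with _ | b
      · exact (h1 rfl).elim
      · cases b <;> simp [hb]
    rw [hbit]
    rcases lt_or_ge i n with h | h
    · have := getElem?_encodeRows_graph (decodeGraph w n) (decodeSet w n n)
        (decodeSet w n (n + 1)) ⟨i, h⟩
      dsimp only at this
      have h2 := getElem?_encodeSet ((decodeGraph w n).neighborSet ⟨i, h⟩) ⟨j, hjn⟩
      dsimp only at h2
      rw [this, Option.bind_some, h2]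
      congr 3
      exact propext ⟨fun hb => hadj i h j hjn hb, fun hb => hb.2.1⟩
    · obtain rfl | rfl : i = n ∨ i = n + 1 := by omega
      · have h2 := getElem?_encodeSet (decodeSet w i i) ⟨j, hjn⟩
        dsimp only at h2
        rw [getElem?_encodeRows_start, Option.bind_some, h2]
        rfl
      · have h2 := getElem?_encodeSet (decodeSet w n (n + 1)) ⟨j, hjn⟩
        dsimp only at h2
        rw [getElem?_encodeRows_target, Option.bind_some, h2]
        rfl
  · obtain ⟨A, hA⟩ := exists_getElem?_encodeRows (decodeGraph w j) (decodeSet w j j)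
      (decodeSet w j (j + 1)) hi
    rw [hA, Option.bind_some, getElem?_encodeSet_last]
    exact (hsep i hi j hj).2 rfl

/-- The number of vertices is smaller than the length of the word, so the instance is found by a
bounded search for `n`; graph and sets are then read off the word. -/
theorem mem_idpOffReconfTS_iff (w : List Letter) :
    w ∈ IdpOffReconfTS ↔ ∃ n < w.length, Format w n ∧ w.length = (n + 2) * (n + 1) ∧
      IsIndepOffensiveAlliance (decodeGraph w n) (decodeSet w n n) ∧
      IsIndepOffensiveAlliance (decodeGraph w n) (decodeSet w n (n + 1)) ∧
      Matched (decodeGraph w n) (decodeSet w n n) (decodeSet w n (n + 1)) ∧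
      Matched (decodeGraph w n) (decodeSet w n (n + 1)) (decodeSet w n n) := by
  constructor
  · rintro ⟨n, G, As, At, rfl, h1, h2, h3⟩
    have h4 := (exists_isReconfSeq_iff h1 h2).1 h3
    have hlen := length_encodeInstance G As At
    have e0 := format_encodeInstance_append G As At []
    have e1 := decodeGraph_encodeInstance_append G As At []
    have e2 := decodeSet_start G As At []
    have e3 := decodeSet_target G As At []
    rw [List.append_nil] at e0 e1 e2 e3
    refine ⟨n, by rw [hlen]; nlinarith, e0, hlen, ?_⟩
    rw [e1, e2, e3]
    exact ⟨h1, h2, h4.1, h4.2⟩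
  · rintro ⟨n, -, hF, hlen, h1, h2, h3⟩
    have := eq_encodeInstance_append hF
    rw [List.drop_eq_nil_of_le hlen.le, List.append_nil] at this
    exact ⟨n, _, _, _, this, h1, h2, (exists_isReconfSeq_iff h1 h2).2 h3⟩

/-! ### Recognizing the binary time bound -/

/-- The number with the given binary digits, least significant digit first. -/
def lettersValue : List Letter → ℕ
  | [] => 0
  | a :: l => (if a = some true then 1 else 0) + 2 * lettersValue l

/-- The word `l` is the binary representation of a number. -/
def IsBinary (l : List Letter) : Prop := (∀ a ∈ l, a ≠ none) ∧ ∀ a ∈ l.getLast?, a = some true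

theorem lettersValue_bits (T : ℕ) : lettersValue ((Nat.bits T).map some) = T := by
  induction T using Nat.binaryRec' with
  | zero => simp [lettersValue]
  | bit b T h ih =>
    rw [Nat.bits_append_bit _ _ h, List.map_cons, lettersValue, ih, Nat.bit_val]
    cases b <;> simp [add_comm]

theorem isBinary_bits (T : ℕ) : IsBinary ((Nat.bits T).map some) := by
  refine ⟨fun a ha => ?_, ?_⟩
  · obtain ⟨b, -, rfl⟩ := List.mem_map.1 ha
    simp
  induction T using Nat.binaryRec' with
  | zero => simp
  | bit b T h ih =>
    rw [Nat.bits_append_bit _ _ h, List.map_cons]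
    by_cases hT : T = 0
    · simp [hT, h hT]
    · have : (Nat.bits T).map some ≠ [] := by
        intro h
        apply hT
        rw [← lettersValue_bits T, h]
        rfl
      rw [List.getLast?_cons_of_ne_nil this]
      exact ih

/-- The condition on the last letter forbids superfluous zeros: a tail of value zero is empty, so
the digit before it is the last one and must be a one. This makes the representation unique. -/
theorem eq_bits_of_isBinary {l : List Letter} (h : IsBinary l) :
    l = (Nat.bits (lettersValue l)).map some := by
  induction l with
  | nil => simp [lettersValue]
  | cons a l ih =>
    obtain ⟨b, rfl⟩ : ∃ b, a = some b := Option.ne_none_iff_exists'.1 (h.1 a (by simp))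
    have hl : IsBinary l := by
      refine ⟨fun a ha => h.1 a (by simp [ha]), fun a ha => h.2 a ?_⟩
      have : l ≠ [] := by rintro rfl; simp at ha
      rwa [List.getLast?_cons_of_ne_nil this]
    have hb : lettersValue l = 0 → b = true := by
      intro h0
      have : l = [] := by rw [ih hl, h0]; simp
      subst this
      simpa using h.2 (some b) (by simp)
    have hval : lettersValue (some b :: l) = Nat.bit b (lettersValue l) := by
      rw [lettersValue, Nat.bit_val]
      cases b <;> simp [add_comm]
    rw [hval, Nat.bits_append_bit _ _ hb, List.map_cons, ← ih hl]

theorem mem_timedIdpOffReconfTS_iff (w : List Letter) :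
    w ∈ TimedIdpOffReconfTS ↔ ∃ n < w.length, Format w n ∧
      IsBinary (w.drop ((n + 2) * (n + 1))) ∧
      IsIndepOffensiveAlliance (decodeGraph w n) (decodeSet w n n) ∧
      IsIndepOffensiveAlliance (decodeGraph w n) (decodeSet w n (n + 1)) ∧
      Matched (decodeGraph w n) (decodeSet w n n) (decodeSet w n (n + 1)) ∧
      Matched (decodeGraph w n) (decodeSet w n (n + 1)) (decodeSet w n n) ∧
      (decodeSet w n n \ decodeSet w n (n + 1)).ncard + 1
        < lettersValue (w.drop ((n + 2) * (n + 1))) := by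
  constructor
  · rintro ⟨n, G, As, At, T, rfl, h1, h2, h3⟩
    have h4 := (exists_isReconfSeq_length_lt_iff h1 h2 T).1 h3
    have hlen := length_encodeInstance G As At
    have hdrop : (encodeTimedInstance G As At T).drop ((n + 2) * (n + 1))
        = (Nat.bits T).map some := by
      rw [← hlen, encodeTimedInstance, List.drop_left]
    refine ⟨n, by rw [encodeTimedInstance, List.length_append, hlen]; nlinarith,
      format_encodeInstance_append G As At _, ?_⟩
    rw [hdrop, lettersValue_bits, encodeTimedInstance, decodeGraph_encodeInstance_append,
      decodeSet_start, decodeSet_target]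
    exact ⟨isBinary_bits T, h1, h2, h4⟩
  · rintro ⟨n, -, hF, hB, h1, h2, h3⟩
    refine ⟨n, _, _, _, lettersValue (w.drop ((n + 2) * (n + 1))), ?_, h1, h2,
      (exists_isReconfSeq_length_lt_iff h1 h2 _).2 h3⟩
    rw [encodeTimedInstance, ← eq_bits_of_isBinary hB]
    exact eq_encodeInstance_append hF

end AllianceReconf

/-! ### The decision problems in logarithmic space -/

namespace AllianceReconf

open LogFun

theorem logPred_getElem? (a : Letter) {k : ℕ} {x : List Letter → (Fin k → ℕ) → ℕ}
    (hx : LogFun x) : LogPred (fun w v => w[x w v]? = some a) :=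
  (LogPred.symbol (fun s => match s with | .letter b => decide (b = a) | _ => false) hx).congr
    fun w v => by
      simp only [OfflineTM.inputAt]
      cases w[x w v]? <;> simp

/-! ### Alliances, matchings and the time bound as logarithmic-space predicates -/

section

variable {k : ℕ} {n i j r r' : List Letter → (Fin k → ℕ) → ℕ}

theorem logPred_bitAt (hn : LogFun n) (hi : LogFun i) (hj : LogFun j) :
    LogPred (fun w v => BitAt w (n w v) (i w v) (j w v)) :=
  logPred_getElem? (some true) ((hi.mul hn.succ).add hj)

theorem logPred_adjAt (hn : LogFun n) (hi : LogFun i) (hj : LogFun j) :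
    LogPred (fun w v => AdjAt w (n w v) (i w v) (j w v)) :=
  (LogPred.eq hi hj).not.and ((logPred_bitAt hn hi hj).and (logPred_bitAt hn hj hi))

theorem logPred_format (hn : LogFun n) : LogPred (fun w v => Format w (n w v)) := by
  have hn₂ := (hn.rename Fin.succ).rename Fin.succ
  refine (LogPred.le (hn.succ.succ.mul hn.succ) length).and (LogPred.and ?_ ?_)
  -- Each quantifier adds a variable in front: `var 0` is the inner index, `var 1` the outer one,
  -- and functions of the old variables are shifted by `Fin.succ`.
  · exact LogPred.forall_lt hn.succ.succ (LogPred.forall_lt (hn.rename Fin.succ).succ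
      ((logPred_getElem? none (((var 1).mul hn₂.succ).add (var 0))).iff
        (LogPred.eq (var 0) hn₂)))
  · exact LogPred.forall_lt hn (LogPred.forall_lt (hn.rename Fin.succ)
      ((logPred_bitAt hn₂ (var 1) (var 0)).imp (logPred_adjAt hn₂ (var 1) (var 0))))

open Classical in
/-- The number of neighbours of `v` with the property `P` in the decoded graph. -/
noncomputable def degAt (w : List Letter) (n v : ℕ) (P : ℕ → Prop) : ℕ :=
  ((Finset.range n).filter fun u => AdjAt w n v u ∧ P u).card

theorem logFun_degAt {P : List Letter → (Fin k → ℕ) → ℕ → Prop} (hn : LogFun n) (hi : LogFun i)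
    (hP : LogPred fun w (v : Fin (k + 1) → ℕ) => P w (fun i => v i.succ) (v 0)) :
    LogFun (fun w v => degAt w (n w v) (i w v) (P w v)) :=
  (LogPred.card (P := fun w u v => AdjAt w (n w v) (i w v) u ∧ P w v u) hn
    ((logPred_adjAt (hn.rename Fin.succ) (hi.rename Fin.succ) (var 0)).and hP)).congr
    fun w v => by simp only [degAt]; congr

theorem degIn_decodeGraph (w : List Letter) (n : ℕ) (P : ℕ → Prop) (v : Fin n) :
    degIn (decodeGraph w n) {u | P u} v = degAt w n v P := by
  classical
  rw [degAt, ← ncard_setOf_fin]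
  rfl

theorem isIndepOffensiveAlliance_decode_iff (w : List Letter) (n r : ℕ) :
    IsIndepOffensiveAlliance (decodeGraph w n) (decodeSet w n r) ↔
      (∀ v < n, (∃ u < n, BitAt w n r u ∧ AdjAt w n u v) → ¬ BitAt w n r v →
        degAt w n v (fun u => ¬ BitAt w n r u) + 1 ≤ degAt w n v (BitAt w n r)) ∧
      ∀ u < n, ∀ v < n, BitAt w n r u → BitAt w n r v → u ≠ v → ¬ AdjAt w n u v := by
  refine and_congr ⟨fun h v hv hu hvr => ?_, fun h v hv => ?_⟩
    ⟨fun h u hu v hv hur hvr huv => ?_, fun h u hu v hv huv => ?_⟩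
  · obtain ⟨u, hun, hur, huv⟩ := hu
    have := h ⟨v, hv⟩ ⟨⟨⟨u, hun⟩, hur, huv⟩, hvr⟩
    rw [← degIn_decodeGraph w n _ ⟨v, hv⟩, ← degIn_decodeGraph w n _ ⟨v, hv⟩]
    exact this
  · obtain ⟨⟨u, hu, huv⟩, hv⟩ := hv
    have := h v v.2 ⟨u, u.2, hu, huv⟩ hv
    rw [← degIn_decodeGraph, ← degIn_decodeGraph] at this
    exact this
  · exact h (show (⟨u, hu⟩ : Fin n) ∈ decodeSet w n r from hur)
      (show (⟨v, hv⟩ : Fin n) ∈ decodeSet w n r from hvr) (fun e => huv (congrArg Fin.val e))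
  · exact h u u.2 v v.2 hu hv (fun e => huv (Fin.ext e))

theorem logPred_isIndepOffensiveAlliance (hn : LogFun n) (hr : LogFun r) :
    LogPred (fun w v =>
      IsIndepOffensiveAlliance (decodeGraph w (n w v)) (decodeSet w (n w v) (r w v))) := by
  refine LogPred.congr ?_ fun w v => (isIndepOffensiveAlliance_decode_iff w (n w v) (r w v)).symm
  have hn₁ := hn.rename Fin.succ
  have hr₁ := hr.rename Fin.succ
  have hn₂ := hn₁.rename Fin.succ
  have hr₂ := hr₁.rename Fin.succ
  refine LogPred.and ?_ ?_
  · refine LogPred.forall_lt hn (LogPred.imp ?_ (LogPred.imp ?_ ?_))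
    · exact LogPred.exists_lt hn₁ ((logPred_bitAt hn₂ hr₂ (var 0)).and
        (logPred_adjAt hn₂ (var 0) (var 1)))
    · exact (logPred_bitAt hn₁ hr₁ (var 0)).not
    · exact LogPred.le
        (logFun_degAt (P := fun w v u => ¬ BitAt w (n w fun i => v i.succ) (r w fun i => v i.succ) u)
          hn₁ (var 0) (logPred_bitAt hn₂ hr₂ (var 0)).not).succ
        (logFun_degAt (P := fun w v u => BitAt w (n w fun i => v i.succ) (r w fun i => v i.succ) u)
          hn₁ (var 0) (logPred_bitAt hn₂ hr₂ (var 0)))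
  · exact LogPred.forall_lt hn (LogPred.forall_lt hn₁
      ((logPred_bitAt hn₂ hr₂ (var 1)).imp ((logPred_bitAt hn₂ hr₂ (var 0)).imp
        ((LogPred.eq (var 1) (var 0)).not.imp (logPred_adjAt hn₂ (var 1) (var 0)).not))))

theorem isLeaf_decode_iff (w : List Letter) (n : ℕ) (v : Fin n) :
    IsLeaf (decodeGraph w n) v ↔ degAt w n v (fun _ => True) = 1 := by
  rw [← degIn_decodeGraph, IsLeaf, degIn]
  have : {u : Fin n | True} = Set.univ := rfl
  rw [this, Set.inter_univ]

theorem matched_decode_iff (w : List Letter) (n r r' : ℕ) :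
    Matched (decodeGraph w n) (decodeSet w n r) (decodeSet w n r') ↔
      ∀ v < n, BitAt w n r v → ¬ BitAt w n r' v → ∃ u < n, BitAt w n r' u ∧ AdjAt w n v u ∧
        degAt w n v (fun _ => True) = 1 ∧ degAt w n u (fun _ => True) = 1 := by
  constructor
  · intro h v hv h1 h2
    obtain ⟨u, hu, h3, h4, h5⟩ := h ⟨v, hv⟩ ⟨h1, h2⟩
    rw [isLeaf_decode_iff] at h4 h5
    exact ⟨u, u.2, hu, h3, h4, h5⟩
  · intro h v hv
    obtain ⟨u, hu, h2, h3, h4, h5⟩ := h v v.2 hv.1 hv.2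
    exact ⟨⟨u, hu⟩, h2, h3, (isLeaf_decode_iff w n v).2 h4, (isLeaf_decode_iff w n ⟨u, hu⟩).2 h5⟩

theorem logPred_true : LogPred (fun (_ : List Letter) (_ : Fin k → ℕ) => True) :=
  (LogPred.eq (const 0) (const 0)).congr fun _ _ => by simp

theorem logPred_matched (hn : LogFun n) (hr : LogFun r) (hr' : LogFun r') :
    LogPred (fun w v => Matched (decodeGraph w (n w v)) (decodeSet w (n w v) (r w v))
      (decodeSet w (n w v) (r' w v))) := by
  refine LogPred.congr ?_ fun w v => (matched_decode_iff w (n w v) (r w v) (r' w v)).symm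
  have hn₁ := hn.rename Fin.succ
  have hn₂ := hn₁.rename Fin.succ
  have hr₁ := hr.rename Fin.succ
  have hr'₁ := hr'.rename Fin.succ
  exact LogPred.forall_lt hn ((logPred_bitAt hn₁ hr₁ (var 0)).imp
    ((logPred_bitAt hn₁ hr'₁ (var 0)).not.imp (LogPred.exists_lt hn₁
      ((logPred_bitAt hn₂ (hr'₁.rename Fin.succ) (var 0)).and
        ((logPred_adjAt hn₂ (var 1) (var 0)).and
          ((LogPred.eq (logFun_degAt (P := fun _ _ _ => True) hn₂ (var 1) logPred_true)
            (const 1)).and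
          (LogPred.eq (logFun_degAt (P := fun _ _ _ => True) hn₂ (var 0) logPred_true)
            (const 1))))))))

open Classical in
theorem logFun_ncard_diff (hn : LogFun n) (hr : LogFun r) (hr' : LogFun r') :
    LogFun (fun w v => (decodeSet w (n w v) (r w v) \ decodeSet w (n w v) (r' w v)).ncard) := by
  refine (LogPred.card (P := fun w u v => BitAt w (n w v) (r w v) u ∧ ¬ BitAt w (n w v) (r' w v) u)
    hn ((logPred_bitAt (hn.rename Fin.succ) (hr.rename Fin.succ) (var 0)).and
      (logPred_bitAt (hn.rename Fin.succ) (hr'.rename Fin.succ) (var 0)).not)).congr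
    fun w v => ?_
  rw [← ncard_setOf_fin]
  rfl

theorem isBinary_drop_iff (w : List Letter) (m : ℕ) :
    IsBinary (w.drop m) ↔ (∀ p < w.length, m ≤ p → ¬ w[p]? = some none) ∧
      (m < w.length → w[w.length - 1]? = some (some true)) := by
  refine and_congr ⟨fun h p hp hm hw => ?_, fun h a ha => ?_⟩ ?_
  · refine h none (List.mem_iff_getElem?.2 ⟨p - m, ?_⟩) rfl
    rw [List.getElem?_drop, ← hw]
    congr 1
    omega
  · rintro rfl
    obtain ⟨q, hq⟩ := List.mem_iff_getElem?.1 ha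
    rw [List.getElem?_drop] at hq
    exact h (m + q) (List.getElem?_eq_some_iff.1 hq).1 (by omega) hq
  · rw [List.getLast?_drop, List.getLast?_eq_getElem?]
    split_ifs with h
    · simp [h.not_gt]
    · push Not at h
      rw [List.getElem?_eq_getElem (by omega)]
      simp [h]

theorem logPred_isBinary_drop {m : List Letter → (Fin k → ℕ) → ℕ} (hm : LogFun m) :
    LogPred (fun w v => IsBinary (w.drop (m w v))) := by
  refine LogPred.congr ?_ fun w v => (isBinary_drop_iff w (m w v)).symm
  refine LogPred.and ?_ ?_
  · exact LogPred.forall_lt length ((LogPred.le (hm.rename Fin.succ) (var 0)).imp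
      (logPred_getElem? none (var 0)).not)
  · exact (LogPred.lt hm length).imp (logPred_getElem? (some true) (length.sub (const 1)))

-- Horner's rule from the end of the word: lengthening the suffix to the left adds a less
-- significant digit and doubles the rest.
open Classical in
theorem lettersValue_drop (w : List Letter) {j : ℕ} (hj : j < w.length) :
    lettersValue (w.drop (w.length - (j + 1))) =
      (if w[w.length - 1 - j]? = some (some true) then 1 else 0)
        + 2 * lettersValue (w.drop (w.length - j)) := by
  rw [List.drop_eq_getElem_cons (by omega), lettersValue,
    show w.length - (j + 1) + 1 = w.length - j by omega,
    show w.length - 1 - j = w.length - (j + 1) by omega,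
    List.getElem?_eq_getElem (by omega)]
  simp

/-- A number given in binary can be compared with a small number by evaluating it, from the most
significant digit on, up to a bound. -/
theorem logPred_lt_lettersValue_drop {x m : List Letter → (Fin k → ℕ) → ℕ} (hx : LogFun x)
    (hm : LogFun m) : LogPred (fun w v => x w v < lettersValue (w.drop (m w v))) := by
  have hx₂ := (hx.rename Fin.succ).rename Fin.succ
  have hstep := ((logPred_getElem? (some true) ((length.sub (const 1)).sub
    (var (0 : Fin (k + 2))))).ite (const 1) (const 0)).add ((const 2).mul (var 1))
  -- Cutting off at `x + 1` keeps the values small, commutes with the Horner step and still decides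
  -- the strict inequality.
  have hR := primrec (fun w v j => min (lettersValue (w.drop (w.length - j))) (x w v + 1))
    (length.sub hm) (const 0)
    -- The minimum of `u` and `c` is written as `u - (u - c)`. Once `j` reaches the length of the
    -- word the suffix no longer grows, and the value is kept.
    ((LogPred.lt (var 0) length).ite (hstep.sub (hstep.sub hx₂.succ)) (var 1))
    (fun w v => by simp [lettersValue]) (fun w v j => ?_) ?_
  · refine (LogPred.lt hx hR).congr fun w v => ?_
    rcases le_total (m w v) w.length with h | h
    · rw [show w.length - (w.length - m w v) = m w v by omega]
      omega
    · rw [show w.length - (w.length - m w v) = w.length by omega, List.drop_length,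
        List.drop_eq_nil_of_le h]
      simp [lettersValue]
  · simp only [Fin.cons_zero, Fin.cons_one, Fin.cons_succ]
    change _ = if j < w.length then _ + _ - (_ + _ - (x w v + 1)) else _
    split_ifs with h₁ h₂
    · rw [lettersValue_drop w h₁, if_pos h₂]
      omega
    · rw [lettersValue_drop w h₁, if_neg h₂]
      omega
    · rw [show w.length - (j + 1) = w.length - j by omega]
  · obtain ⟨e, he⟩ := hx.succ.polyBounded
    exact ⟨e, fun w v N hw hv j _ => (min_le_right _ _).trans (he w v N hw hv)⟩

end

theorem idpOffReconfTS_mem_logSPACE : IdpOffReconfTS ∈ LogSPACE Letter := by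
  refine LogPred.mem_logSPACE (P := fun w _ => w ∈ IdpOffReconfTS)
    ((LogPred.exists_lt length ?_).congr fun w _ => (mem_idpOffReconfTS_iff w).symm) fun _ => Iff.rfl
  have hn : LogFun (fun (_ : List Letter) (v : Fin 1 → ℕ) => v 0) := var 0
  exact (logPred_format hn).and ((LogPred.eq length (hn.succ.succ.mul hn.succ)).and
    ((logPred_isIndepOffensiveAlliance hn hn).and
    ((logPred_isIndepOffensiveAlliance hn hn.succ).and
    ((logPred_matched hn hn hn.succ).and (logPred_matched hn hn.succ hn)))))

theorem timedIdpOffReconfTS_mem_logSPACE : TimedIdpOffReconfTS ∈ LogSPACE Letter := by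
  refine LogPred.mem_logSPACE (P := fun w _ => w ∈ TimedIdpOffReconfTS)
    ((LogPred.exists_lt length ?_).congr fun w _ => (mem_timedIdpOffReconfTS_iff w).symm) fun _ => Iff.rfl
  have hn : LogFun (fun (_ : List Letter) (v : Fin 1 → ℕ) => v 0) := var 0
  have hm := hn.succ.succ.mul hn.succ
  exact (logPred_format hn).and ((logPred_isBinary_drop hm).and
    ((logPred_isIndepOffensiveAlliance hn hn).and
    ((logPred_isIndepOffensiveAlliance hn hn.succ).and
    ((logPred_matched hn hn hn.succ).and ((logPred_matched hn hn.succ hn).and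
    (logPred_lt_lettersValue_drop (logFun_ncard_diff hn hn hn.succ).succ hm))))))

end AllianceReconf

theorem mainTheorem5 :
    (∀ (V : Type*) [Finite V] (G : SimpleGraph V) (A B : Set V),
      AllianceReconf.IsIndepOffensiveAlliance G A →
      AllianceReconf.IsIndepOffensiveAlliance G B →
      AllianceReconf.IsTokenSlide G A B →
      ∀ x ∈ A \ B, ∀ y ∈ B \ A, AllianceReconf.IsIsolatedEdge G x y) ∧
    AllianceReconf.IdpOffReconfTS ∈ LogSPACE AllianceReconf.Letter ∧
    AllianceReconf.TimedIdpOffReconfTS ∈ LogSPACE AllianceReconf.Letter :=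
  ⟨fun _ _ _ _ _ hA hB h _ hx _ hy => h.isIsolatedEdge hA hB hx hy,
    AllianceReconf.idpOffReconfTS_mem_logSPACE, AllianceReconf.timedIdpOffReconfTS_mem_logSPACE⟩
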